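/- Let $D\subset\mathbb R^n\times\mathbb R$ be open, let $k\ge 1$, and consider a scalar partial differential equation $$U(x,u,u_{(1)},\dots,u_{(k)})=0 \qquad (1)$$ for $u=u(x)$, $x=(x_1,\dots,x_n)$, where $u_{(j)}$ denotes all derivatives of order $j$ and $U$ is a smooth function on an open set of jets. All vector fields below are smooth on $D$ and have the form $\xi^l(x,u)\partial_{x_l}+\eta(x,u)\partial_u$. (a) Let $AG_s$ be an $s$-dimensional Lie algebra of vector fields on $D$ under which (1) is invariant in the sense of Lie: over $D$, the $k$-th prolongation of each $X\in AG_s$ annihilates $U$ at all jets with $U=0$. (b) Let $Q_a=\xi_a^l(x,u)\partial_{x_l}+\eta_a(x,u)\partial_u$, $a=1,\dots,m$, be an involutive family ($[Q_a,Q_b]$ is a combination of the $Q_c$ with functions as coefficients) under which (1) is conditionally invariant: over $D$, the prolongation of each $Q_a$ annihilates $U$ at all jets which satisfy $U=0$, the system $$\xi_a^l(x,u)\frac{\partial u}{\partial x_l}=\eta_a(x,u),\qquad a=1,\dots,m, \qquad (2)$$ and all differential consequences of (2) up to order $k$. (c) Let the matrix $(\xi_a^l)$ have rank $n-1$ on $D$,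 let $\tau(x,u),\zeta(x,u)$ be smooth functionally independent invariants of the family on $D$ ($Q_a\tau=Q_a\zeta=0$), and suppose that the corresponding ansatz $\zeta(x,u)=\varphi(\tau(x,u))$ reduces (1) to an ordinary differential equation $H(\tau,\varphi,\varphi',\dots,\varphi^{(k_1)})=0$ of order $k_1\le k$. This means that $H$ is smooth on an open set, $\partial H/\partial\varphi^{(k_1)}\ne0$ wherever $H=0$, and substitution of the ansatz into $U$ gives $\lambda H$ with a smooth nowhere vanishing function $\lambda$ of $x,u,\varphi,\varphi',\dots,\varphi^{(k)}$. (d) Let the system (2) also be invariant, in the sense of Lie, under $AG_s$ over $D$, and let $s\ge k_1+1$. Then every conditionally invariant solution of (1) with respect to $\{Q_a\}$ is an invariant solution in the classical Lie sense. That is, let $\Omega\subset\mathbb R^n$ be a nonempty connected open set and let $f\in C^k(\Omega)$ be a solution of (1) and (2) whose graph lies in $D$ and which near each point of $\Omega$ has the form $\zeta(x,f(x))=\varphi(\tau(x,f(x)))$ for some $\varphi$ of class $C^k$. Then there is a nonzero vector field $Y=\xi^l\partial_{x_l}+\eta\partial_u\in AG_s$ such that $\eta(x,f(x))=\xi^l(x,f(x))\,\partial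 f/\partial x_l(x)$ for all $x\in\Omega$. -/

import Mathlib

open Set Filter Topology
open scoped ContDiff

namespace SymRed

/-- The space of the independent variables `x = (x₁, …, xₙ)`. -/
abbrev Base (n : ℕ) : Type := EuclideanSpace ℝ (Fin n)

/-- The space of the pairs `(x, u)`. -/
abbrev Pt (n : ℕ) : Type := Base n × ℝ

/-- A vector field `ξ^l(x,u) ∂_{x_l} + η(x,u) ∂_u`; at `p = (x, u)` its value is the
pair `(ξ(x,u), η(x,u))`. -/
abbrev VField (n : ℕ) : Type := Pt n → Pt n

/-- Jets of order `k`: the point `x` together with the value and all the derivatives of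
order at most `k`; the derivatives of order `j` are collected in a `j`-linear form (its values on
the basis vectors are the partial derivatives of order `j`). -/
abbrev Jet (n k : ℕ) : Type :=
  Base n × ((j : Fin (k + 1)) → ContinuousMultilinearMap ℝ (fun _ : Fin (j : ℕ) => Base n) ℝ)

/-- The point `(x, u)` below a jet. -/
def Jet.point {n k : ℕ} (J : Jet n k) : Pt n := (J.1, J.2 0 (fun _ => 0))

/-- The `k`-jet of `f` at `x`. -/
noncomputable def jet {n : ℕ} (k : ℕ) (f : Base n → ℝ) (x : Base n) : Jet n k :=
  (x, fun j => iteratedFDeriv ℝ (j : ℕ) f x)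

/-- The characteristic `η(x, f) - ξ^l(x, f) ∂f/∂x_l` of the vector field `X` along `f`. -/
noncomputable def characteristic {n : ℕ} (X : VField n) (f : Base n → ℝ) (x : Base n) : ℝ :=
  (X (x, f x)).2 - fderiv ℝ f x (X (x, f x)).1

/-- The value of the `k`-th prolongation of `X` at the `k`-jet of `f` at `x`. Its components
are `ξ` and, for `|α| ≤ k`, the numbers `D_α (η - ξ^l u_l) + ξ^l u_{α,l}`, evaluated along `f`
(the classical prolongation formula; only the `k`-jet of `f` matters). -/
noncomputable def prolong {n : ℕ} (k : ℕ) (X : VField n) (f : Base n → ℝ) (x : Base n) :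
    Jet n k :=
  ((X (x, f x)).1, fun j =>
    iteratedFDeriv ℝ (j : ℕ) (characteristic X f) x
      + fderiv ℝ (fun y => iteratedFDeriv ℝ (j : ℕ) f y) x (X (x, f x)).1)

/-- A system of differential equations of order `k`, given by the functions `eqn i` on the
set `dom` of jets. -/
structure DiffSystem (n k : ℕ) (ι : Type) where
  dom : Set (Jet n k)
  eqn : ι → Jet n k → ℝ

namespace DiffSystem

variable {n k : ℕ} {ι : Type}

/-- The left-hand sides are smooth functions on an open set of jets. -/
def IsRegular (S : DiffSystem n k ι) : Prop :=
  IsOpen S.dom ∧ ∀ i, ContDiffOn ℝ ∞ (S.eqn i) S.dom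

/-- The jet `J` satisfies all equations of the system. -/
def Holds (S : DiffSystem n k ι) (J : Jet n k) : Prop :=
  J ∈ S.dom ∧ ∀ i, S.eqn i J = 0

/-- Classical (Lie point) invariance over the region `D` of the `(x, u)`-space:
the prolongation of `X` annihilates the left-hand sides at every jet that satisfies the system.
Every jet is the jet of a smooth function. -/
def IsInvariant (S : DiffSystem n k ι) (D : Set (Pt n)) (X : VField n) : Prop :=
  ∀ (f : Base n → ℝ) (x : Base n), ContDiffAt ℝ ∞ f x → (x, f x) ∈ D → S.Holds (jet k f x) →
    ∀ i, fderiv ℝ (S.eqn i) (jet k f x) (prolong k X f x) = 0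

/-- Conditional invariance with respect to the family `Q`: the prolongations of the `Q a`
annihilate the left-hand sides at every jet that satisfies the system together with the equations
`η_b - ξ_b^l u_l = 0` and all their differential consequences of order at most `k`. -/
def IsConditionallyInvariant (S : DiffSystem n k ι) (D : Set (Pt n)) {m : ℕ}
    (Q : Fin m → VField n) : Prop :=
  ∀ (f : Base n → ℝ) (x : Base n), ContDiffAt ℝ ∞ f x → (x, f x) ∈ D → S.Holds (jet k f x) →
    (∀ b, ∀ j < k, iteratedFDeriv ℝ j (characteristic (Q b) f) x = 0) →
    ∀ a i, fderiv ℝ (S.eqn i) (jet k f x) (prolong k (Q a) f x) = 0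

end DiffSystem

/-- The first-order system `ξ_a^l(x,u) ∂u/∂x_l = η_a(x,u)` over the region `D`. -/
def invariantSurfaceSystem {n m : ℕ} (D : Set (Pt n)) (Q : Fin m → VField n) :
    DiffSystem n 1 (Fin m) where
  dom := {J | J.point ∈ D}
  eqn := fun a J => (Q a J.point).2 - J.2 1 (fun _ => (Q a J.point).1)

/-- The family is involutive: on `D` the commutators `[Q a, Q b]` are linear combinations of the
`Q c`, with functions as coefficients. -/
def IsInvolutive {n m : ℕ} (D : Set (Pt n)) (Q : Fin m → VField n) : Prop :=
  ∀ a b, ∀ p ∈ D,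
    VectorField.lieBracket ℝ (Q a) (Q b) p ∈ Submodule.span ℝ (range fun c => Q c p)

/-- `X 0, …, X (s-1)` is a basis of an `s`-dimensional Lie algebra of smooth vector fields
on `D`. -/
structure IsLieAlgebraBasis {n s : ℕ} (D : Set (Pt n)) (X : Fin s → VField n) : Prop where
  smooth : ∀ i, ContDiffOn ℝ ∞ (X i) D
  independent : ∀ c : Fin s → ℝ, (∀ p ∈ D, ∑ i, c i • X i p = 0) → c = 0
  bracket : ∀ i j, ∃ c : Fin s → ℝ, ∀ p ∈ D,
    VectorField.lieBracket ℝ (X i) (X j) p = ∑ l, c l • X l p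

/-- `τ` and `ζ` define the ansatz `ζ(x,u) = φ(τ(x,u))` of the family `Q`, with one unknown
function `φ` of one variable: `τ`, `ζ` are functionally independent invariants of the family,
and the matrix `(ξ_a^l)` has rank `n - 1`. -/
structure IsAnsatz {n m : ℕ} (D : Set (Pt n)) (Q : Fin m → VField n) (τ ζ : Pt n → ℝ) :
    Prop where
  smooth_τ : ContDiffOn ℝ ∞ τ D
  smooth_ζ : ContDiffOn ℝ ∞ ζ D
  invariant_τ : ∀ a, ∀ p ∈ D, fderiv ℝ τ p (Q a p) = 0
  invariant_ζ : ∀ a, ∀ p ∈ D, fderiv ℝ ζ p (Q a p) = 0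
  independent : ∀ p ∈ D, LinearIndependent ℝ ![fderiv ℝ τ p, fderiv ℝ ζ p]
  rank : ∀ p ∈ D, Module.finrank ℝ (Submodule.span ℝ (range fun a => (Q a p).1)) + 1 = n

/-- Near `x`, the function `f` has the form given by the ansatz with the function `φ`. -/
def HasAnsatzForm {n : ℕ} (τ ζ : Pt n → ℝ) (φ : ℝ → ℝ) (f : Base n → ℝ) (x : Base n) : Prop :=
  ∀ᶠ y in 𝓝 x, ζ (y, f y) = φ (τ (y, f y))

/-- The values `φ(t), φ'(t), …, φ^{(r)}(t)`. -/
noncomputable def derivs (r : ℕ) (φ : ℝ → ℝ) (t : ℝ) : Fin (r + 1) → ℝ :=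
  fun j => iteratedDeriv (j : ℕ) φ t

/-- An ordinary differential equation `H(t, φ, φ', …, φ^{(r)}) = 0` of order `r`: `H` is smooth
on an open set, and its derivative by the highest derivative does not vanish on `H = 0`. -/
structure ODE (r : ℕ) where
  dom : Set (ℝ × (Fin (r + 1) → ℝ))
  eqn : ℝ × (Fin (r + 1) → ℝ) → ℝ
  isOpen_dom : IsOpen dom
  smooth : ContDiffOn ℝ ∞ eqn dom
  order : ∀ p ∈ dom, eqn p = 0 → fderiv ℝ eqn p (0, Pi.single (Fin.last r) 1) ≠ 0

/-- The ansatz reduces the partial differential equation `P` of order `k` to the ordinary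
differential equation `R` of order `r`: the substitution of the ansatz into the left-hand side of
`P` gives the left-hand side of `R` times a smooth nonvanishing function of
`x, u, φ(τ), …, φ^{(k)}(τ)`. -/
def ReducesTo {n k r : ℕ} (P : DiffSystem n k Unit) (D : Set (Pt n)) (τ ζ : Pt n → ℝ)
    (R : ODE r) : Prop :=
  r ≤ k ∧ ∃ μ : Base n × ℝ × (Fin (k + 1) → ℝ) → ℝ,
    ∀ (f : Base n → ℝ) (φ : ℝ → ℝ) (x : Base n),
      (x, f x) ∈ D → ContDiffAt ℝ k f x → ContDiffAt ℝ k φ (τ (x, f x)) →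
      HasAnsatzForm τ ζ φ f x → jet k f x ∈ P.dom →
        (τ (x, f x), derivs r φ (τ (x, f x))) ∈ R.dom ∧
        ContDiffAt ℝ ∞ μ (x, f x, derivs k φ (τ (x, f x))) ∧
        μ (x, f x, derivs k φ (τ (x, f x))) ≠ 0 ∧
        P.eqn () (jet k f x) =
          μ (x, f x, derivs k φ (τ (x, f x))) *
            R.eqn (τ (x, f x), derivs r φ (τ (x, f x)))

/-- `f` is a conditionally invariant solution of `P` on `Ω`: a solution of class `C^k` both of `P`
and of the system `ξ_a^l ∂u/∂x_l = η_a`, with graph in `D`, which locally is given by the ansatz.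
-/
structure IsConditionallyInvariantSolution {n k m : ℕ} (P : DiffSystem n k Unit) (D : Set (Pt n))
    (Q : Fin m → VField n) (τ ζ : Pt n → ℝ) (Ω : Set (Base n)) (f : Base n → ℝ) : Prop where
  contDiff : ContDiffOn ℝ k f Ω
  graph : ∀ x ∈ Ω, (x, f x) ∈ D
  solves : ∀ x ∈ Ω, P.Holds (jet k f x)
  solves_system : ∀ x ∈ Ω, (invariantSurfaceSystem D Q).Holds (jet 1 f x)
  ansatz : ∀ x ∈ Ω, ∃ φ : ℝ → ℝ, ContDiffAt ℝ k φ (τ (x, f x)) ∧ HasAnsatzForm τ ζ φ f x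

/-- The function `f` on `Ω` is invariant under the vector field `Y` in the classical sense:
`Y` is tangent to the graph of `f`, i.e. `Y (u - f(x)) = 0` where `u = f(x)`. -/
def IsInvariantFunction {n : ℕ} (Y : VField n) (Ω : Set (Base n)) (f : Base n → ℝ) : Prop :=
  ∀ x ∈ Ω, characteristic Y f x = 0

end SymRed

open SymRed

/-!
Let `f` be a conditionally invariant solution and write `T x = τ (x, f x)`. Near a point of `Ω`
the solution is given by `ζ = φ ∘ τ`; independence of `τ` and `ζ` makes `T` a submersion and the
factor `w = ∂(ζ - φ ∘ τ)/∂u` nonzero along the graph. Hence `φ` solves the ordinary differential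
equation `H = 0`, and since the highest derivative can be solved for, `φ` and then `f` are smooth
(`ODE.contDiffAt_solution`, `IsConditionallyInvariantSolution.exists_smooth_ansatz`).

For a vector field `X` of the Lie algebra let `g` be its characteristic along `f`. Invariance of an
equation means that `g` solves the equation linearised at `f`
(`DiffSystem.IsInvariant.fderiv_jet_characteristic`). For the first-order system this says that
`w * g` is constant in the directions `ξ_a`; as these span the kernel of `dT` by the rank condition,
`w * g = χ ∘ T` for a smooth function `χ` of one variable
(`IsAnsatz.fderiv_weight_mul_characteristic`, `exists_factor`). Thus `χ` is the characteristic of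
the vector field induced by `X` on the `(τ, ζ)`-plane, obtained without passing to that plane.

The graphs `ζ = (φ + ε χ) ∘ τ` form a deformation of `f` whose derivative at `ε = 0` is exactly
`g`. Substituting it into the reduction `U = λ H` and differentiating at `ε = 0` turns the
linearised partial differential equation for `g` into the linearised ordinary differential
equation for `χ` (`linearized_ode`). This is a linear equation of order `k₁` with nonvanishing
leading coefficient, so its solutions are determined by `k₁` initial values
(`ODE.exists_nhds_linearized_unique`), and among `s ≥ k₁ + 1` of the functions `χ` some nontrivial
combination vanishes. The corresponding combination of vector fields has vanishing characteristic
near one point. Uniqueness for the linear equation also shows that the set of points near which this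
characteristic vanishes is closed in `Ω`, so it is all of the connected set `Ω`.
-/

namespace SymRed

/-! ### Implicit functions and submersions -/

section Implicit

variable {E : Type*} [NormedAddCommGroup E] [NormedSpace ℝ E] [CompleteSpace E]

/-- The implicit function theorem for one scalar equation `K (q, z) = const` solved for `z`. -/
theorem exists_implicit_function {n : WithTop ℕ∞} (hn : n ≠ 0) {K : E × ℝ → ℝ} {q : E} {z : ℝ}
    (hK : ContDiffAt ℝ n K (q, z)) (hz : fderiv ℝ K (q, z) (0, 1) ≠ 0) :
    ∃ ψ : E → ℝ, ContDiffAt ℝ n ψ q ∧ ψ q = z ∧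
      ∀ᶠ p in 𝓝 (q, z), K p = K (q, z) ↔ ψ p.1 = p.2 := by
  have hinv : (fderiv ℝ K (q, z) ∘L .inr ℝ E ℝ).IsInvertible := by
    refine ⟨ContinuousLinearEquiv.unitsEquivAut ℝ (Units.mk0 _ hz), ?_⟩
    ext
    simp
  exact ⟨hK.implicitFunction hn hinv, hK.contDiffAt_implicitFunction hn hinv,
    hK.implicitFunction_apply_self hn hinv, hK.eventually_apply_eq_iff_implicitFunction hn hinv⟩

/-- A continuous function `z` with `K (q s, z s) = 0` is as smooth as `q` and `K`, because it
coincides with the implicit function. -/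
theorem contDiffAt_of_implicit {F : Type*} [NormedAddCommGroup F] [NormedSpace ℝ F]
    {n : WithTop ℕ∞} (hn : n ≠ 0) {K : E × ℝ → ℝ} {q : F → E} {z : F → ℝ} {t : F}
    (hq : ContDiffAt ℝ n q t) (hzc : ContinuousAt z t)
    (hK : ContDiffAt ℝ n K (q t, z t)) (hz : fderiv ℝ K (q t, z t) (0, 1) ≠ 0)
    (h0 : ∀ᶠ s in 𝓝 t, K (q s, z s) = 0) : ContDiffAt ℝ n z t := by
  obtain ⟨ψ, hψ, -, hψ'⟩ := exists_implicit_function hn hK hz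
  have h1 := (hq.continuousAt.prodMk hzc).eventually hψ'
  refine (hψ.comp t hq).congr_of_eventuallyEq ?_
  filter_upwards [h1, h0] with s hs hs0
  exact ((hs.1 (hs0.trans h0.self_of_nhds.symm))).symm

/-- Submersions are open maps: what holds for the values of `T` near `x₀` holds near `T x₀`. -/
theorem eventually_of_eventually_comp {T : E → ℝ} {x₀ : E} (hT : ContDiffAt ℝ 1 T x₀)
    (hT' : fderiv ℝ T x₀ ≠ 0) {p : ℝ → Prop} (hp : ∀ᶠ x in 𝓝 x₀, p (T x)) :
    ∀ᶠ t in 𝓝 (T x₀), p t := by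
  have hs := (hT.hasStrictFDerivAt one_ne_zero).map_nhds_eq_of_surj (by
    have hsurj : Function.Surjective (fderiv ℝ T x₀ : E →ₗ[ℝ] ℝ) :=
      LinearMap.surjective (by exact_mod_cast hT')
    exact LinearMap.range_eq_top.2 hsurj)
  rw [← hs]
  exact hp

/-- Where `dT ≠ 0`, lines in a fixed direction `v` transversal to the level sets of `T` can be used
to move a point `y` to the level set `T = t`; the step `ψ (y, t)` along `v` depends smoothly on
`(y, t)`. -/
theorem exists_transversal_step {T : E → ℝ} {x₀ : E} (hT : ContDiffAt ℝ ∞ T x₀)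
    (hT' : fderiv ℝ T x₀ ≠ 0) :
    ∃ (v : E) (ψ : E × ℝ → ℝ), ContDiffAt ℝ ∞ ψ (x₀, T x₀) ∧ ψ (x₀, T x₀) = 0 ∧
      (∀ᶠ p in 𝓝 (x₀, T x₀), T (p.1 + ψ p • v) = p.2) ∧ ∀ᶠ x in 𝓝 x₀, ψ (x, T x) = 0 := by
  obtain ⟨v, hv⟩ : ∃ v, fderiv ℝ T x₀ v ≠ 0 := by
    by_contra! hc
    exact hT' (ContinuousLinearMap.ext hc)
  set K : (E × ℝ) × ℝ → ℝ := fun p => T (p.1.1 + p.2 • v) - p.1.2 with hKdef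
  have hbase : x₀ + (0 : ℝ) • v = x₀ := by simp
  have hK : ContDiffAt ℝ ∞ K ((x₀, T x₀), 0) := by
    refine ContDiffAt.sub (ContDiffAt.comp _ (g := T) ?_ ?_) ?_
    · simpa using hT
    · fun_prop
    · fun_prop
  have hKz : fderiv ℝ K ((x₀, T x₀), 0) (0, 1) ≠ 0 := by
    have h1 : HasFDerivAt K (fderiv ℝ K ((x₀, T x₀), 0)) ((x₀, T x₀), 0) :=
      (hK.differentiableAt (by simp)).hasFDerivAt
    have h2 : HasDerivAt (fun z : ℝ => ((x₀, T x₀), z)) ((0 : E × ℝ), (1 : ℝ)) 0 :=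
      (hasDerivAt_const _ _).prodMk (hasDerivAt_id _)
    have h3 := h1.comp_hasDerivAt (0 : ℝ) h2
    have h4 : HasDerivAt (fun z : ℝ => x₀ + z • v) v 0 := by
      simpa using ((hasDerivAt_id (0 : ℝ)).smul_const v).const_add x₀
    have h5 : HasFDerivAt T (fderiv ℝ T x₀) (x₀ + (0 : ℝ) • v) := by
      rw [hbase]; exact (hT.differentiableAt (by simp)).hasFDerivAt
    have h6 := (h5.comp_hasDerivAt (0 : ℝ) h4).sub_const (T x₀)
    rw [h3.unique h6]
    exact hv
  obtain ⟨ψ, hψ, hψ0, hψ'⟩ := exists_implicit_function (by simp) hK hKz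
  have hK0 : K ((x₀, T x₀), 0) = 0 := by simp [hKdef]
  rw [hK0] at hψ'
  have hψc := hψ.continuousAt
  have hTc := hT.continuousAt
  have hψgr : Tendsto (fun p : E × ℝ => (p, ψ p)) (𝓝 (x₀, T x₀)) (𝓝 ((x₀, T x₀), 0)) := by
    have : ContinuousAt (fun p : E × ℝ => (p, ψ p)) (x₀, T x₀) := by fun_prop
    simpa [ContinuousAt, hψ0] using this
  have hTx : Tendsto (fun x => ((x, T x), (0 : ℝ))) (𝓝 x₀) (𝓝 ((x₀, T x₀), 0)) := by
    have : ContinuousAt (fun x => ((x, T x), (0 : ℝ))) x₀ := by fun_prop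
    exact this
  refine ⟨v, ψ, hψ, hψ0, ?_, ?_⟩
  · filter_upwards [hψgr.eventually hψ'] with p hp
    exact sub_eq_zero.1 (hp.2 rfl)
  · filter_upwards [hTx.eventually hψ'] with x hx
    exact hx.1 (by simp [hKdef])

/-- A function whose derivative vanishes on the tangent spaces of the level sets of a submersion
`T` is locally a function of `T`: it is constant along the path inside a level set that is obtained
by moving a segment along a transversal direction. -/
theorem exists_factor {T h : E → ℝ} {x₀ : E} (hT : ContDiffAt ℝ ∞ T x₀)
    (hT' : fderiv ℝ T x₀ ≠ 0) (hh : ContDiffAt ℝ ∞ h x₀)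
    (hker : ∀ᶠ y in 𝓝 x₀, ∀ v, fderiv ℝ T y v = 0 → fderiv ℝ h y v = 0) :
    ∃ χ : ℝ → ℝ, ∀ᶠ x in 𝓝 x₀, h x = χ (T x) := by
  obtain ⟨v, ψ, hψ, hψ0, hTψ, hψT⟩ := exists_transversal_step hT hT'
  have hψc := hψ.continuousAt
  have hpt : Tendsto (fun p : E × ℝ => p.1 + ψ p • v) (𝓝 (x₀, T x₀)) (𝓝 x₀) := by
    have : ContinuousAt (fun p : E × ℝ => p.1 + ψ p • v) (x₀, T x₀) := by fun_prop
    simpa [ContinuousAt, hψ0] using this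
  have hTd : ∀ᶠ y in 𝓝 x₀, DifferentiableAt ℝ T y :=
    ((hT.of_le (m := 1) (by simp)).eventually (by simp)).mono fun y hy =>
      hy.differentiableAt (by simp)
  have hhd : ∀ᶠ y in 𝓝 x₀, DifferentiableAt ℝ h y :=
    ((hh.of_le (m := 1) (by simp)).eventually (by simp)).mono fun y hy =>
      hy.differentiableAt (by simp)
  have hψd : ∀ᶠ p in 𝓝 (x₀, T x₀), DifferentiableAt ℝ ψ p :=
    ((hψ.of_le (m := 1) (by simp)).eventually (by simp)).mono fun y hy =>
      hy.differentiableAt (by simp)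
  have hall : ∀ᶠ p in 𝓝 (x₀, T x₀), DifferentiableAt ℝ ψ p ∧ T (p.1 + ψ p • v) = p.2 ∧
      DifferentiableAt ℝ T (p.1 + ψ p • v) ∧ DifferentiableAt ℝ h (p.1 + ψ p • v) ∧
      ∀ w, fderiv ℝ T (p.1 + ψ p • v) w = 0 → fderiv ℝ h (p.1 + ψ p • v) w = 0 := by
    filter_upwards [hψd, hpt.eventually hTd, hpt.eventually hhd, hpt.eventually hker, hTψ]
      with p h1 h2 h3 h4 h5
    exact ⟨h1, h5, h2, h3, h4⟩
  obtain ⟨r, hr, hball⟩ := Metric.eventually_nhds_iff_ball.1 hall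
  refine ⟨fun t => h (x₀ + ψ (x₀, t) • v), ?_⟩
  filter_upwards [hψT, Metric.ball_mem_nhds x₀ hr,
    hT.continuousAt (Metric.ball_mem_nhds (T x₀) hr)] with x hψx hxb hTb
  -- a segment from `x` to `x₀`, moved along `v` into the level set of `x`
  set y : ℝ → E := fun σ => x + σ • (x₀ - x) with hy
  have hyd : ∀ σ, HasDerivAt y (x₀ - x) σ := fun σ => by
    simpa [hy] using ((hasDerivAt_id σ).smul_const (x₀ - x)).const_add x
  have hyb : ∀ σ ∈ Icc (0 : ℝ) 1, (y σ, T x) ∈ Metric.ball (x₀, T x₀) r := by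
    intro σ hσ
    rw [← ball_prod_same]
    refine ⟨?_, hTb⟩
    have := (convex_ball x₀ r).add_smul_sub_mem hxb (Metric.mem_ball_self hr) hσ
    exact this
  have hcont : ∀ σ, ContinuousAt (fun σ => (y σ, T x)) σ := fun σ =>
    (hyd σ).continuousAt.prodMk continuousAt_const
  have hder : ∀ σ ∈ Icc (0 : ℝ) 1,
      HasDerivAt (fun σ => h (y σ + ψ (y σ, T x) • v)) 0 σ := by
    intro σ hσ
    obtain ⟨h1, -, h3, h4, h5⟩ := hball _ (hyb σ hσ)
    have e1 := (hyd σ).prodMk (hasDerivAt_const σ (T x))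
    have e2 := h1.hasFDerivAt.comp_hasDerivAt σ e1
    have e3 := (hyd σ).add (e2.smul_const v)
    have e4 := h3.hasFDerivAt.comp_hasDerivAt σ e3
    have e5 := h4.hasFDerivAt.comp_hasDerivAt σ e3
    have e6 : HasDerivAt (fun σ => T (y σ + ψ (y σ, T x) • v)) 0 σ := by
      refine (hasDerivAt_const σ (T x)).congr_of_eventuallyEq ?_
      filter_upwards [(hcont σ).eventually (Metric.isOpen_ball.mem_nhds (hyb σ hσ))] with ρ hρ
      exact (hball _ hρ).2.1
    have e7 := h5 _ (e4.unique e6)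
    have e8 : HasDerivAt (fun σ => h (y σ + ψ (y σ, T x) • v)) _ σ := e5
    rwa [e7] at e8
  have := constant_of_has_deriv_right_zero (a := (0 : ℝ)) (b := 1)
    (fun σ hσ => (hder σ hσ).continuousAt.continuousWithinAt)
    (fun σ hσ => (hder σ ⟨hσ.1, hσ.2.le⟩).hasDerivWithinAt) 1 (by simp)
  simp only [hy, one_smul, zero_smul, add_zero, add_sub_cancel, hψx] at this
  exact this.symm

/-- If `χ ∘ T` is smooth and `T` is a submersion, then `χ` is smooth, since `T` has smooth local
sections. -/
theorem contDiffAt_of_comp {T h : E → ℝ} {χ : ℝ → ℝ} {x₀ : E} (hT : ContDiffAt ℝ ∞ T x₀)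
    (hT' : fderiv ℝ T x₀ ≠ 0) (hh : ContDiffAt ℝ ∞ h x₀)
    (hχ : ∀ᶠ x in 𝓝 x₀, h x = χ (T x)) : ContDiffAt ℝ ∞ χ (T x₀) := by
  obtain ⟨v, ψ, hψ, hψ0, hTψ, -⟩ := exists_transversal_step hT hT'
  have hσ : ContDiffAt ℝ ∞ (fun t => x₀ + ψ (x₀, t) • v) (T x₀) := by
    have : ContDiffAt ℝ ∞ (fun t => ψ (x₀, t)) (T x₀) :=
      ContDiffAt.comp (f := fun t : ℝ => (x₀, t)) (T x₀) hψ (by fun_prop)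
    fun_prop
  have hσ0 : x₀ + ψ (x₀, T x₀) • v = x₀ := by simp [hψ0]
  have hsec : Tendsto (fun t => x₀ + ψ (x₀, t) • v) (𝓝 (T x₀)) (𝓝 x₀) := by
    simpa [ContinuousAt, hσ0] using hσ.continuousAt
  have hsm : ContDiffAt ℝ ∞ (fun t => h (x₀ + ψ (x₀, t) • v)) (T x₀) :=
    ContDiffAt.comp (T x₀) (g := h) (by rwa [hσ0]) hσ
  have hline : ContinuousAt (fun t : ℝ => (x₀, t)) (T x₀) := by fun_prop
  refine hsm.congr_of_eventuallyEq ?_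
  filter_upwards [hline.eventually hTψ, hsec.eventually hχ] with t h1 h2
  rw [h2, h1]

end Implicit

/-! ### Derivatives depending on a parameter -/

section IteratedDerivatives

theorem natCast_ne_infty (n : ℕ) : (n : ℕ∞ω) ≠ ∞ := by exact_mod_cast ENat.natCast_ne_top n

theorem natCast_le_infty (n : ℕ) : (n : ℕ∞ω) ≤ ∞ := by exact_mod_cast le_top

variable {E G : Type*} [NormedAddCommGroup E] [NormedSpace ℝ E]
  [NormedAddCommGroup G] [NormedSpace ℝ G]

/-- A directional derivative commutes with the iterated derivatives. -/
theorem fderiv_iteratedFDeriv_apply (j : ℕ) {F : E → G} {z : E} (v : E)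
    (hF : ContDiffAt ℝ (j + 2 : ℕ) F z) :
    fderiv ℝ (iteratedFDeriv ℝ j F) z v = iteratedFDeriv ℝ j (fun w => fderiv ℝ F w v) z := by
  induction j generalizing z with
  | zero =>
    ext m
    have h1 : iteratedFDeriv ℝ 0 F =
      (continuousMultilinearCurryFin0 ℝ E G).symm ∘ F := iteratedFDeriv_zero_eq_comp
    rw [h1, LinearIsometryEquiv.comp_fderiv]
    simp
  | succ j ih =>
    have hev : ∀ᶠ y in 𝓝 z, fderiv ℝ (iteratedFDeriv ℝ j F) y v =
        iteratedFDeriv ℝ j (fun w => fderiv ℝ F w v) y := by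
      filter_upwards [hF.eventually (natCast_ne_infty _)] with y hy
      exact ih (hy.of_le (by exact_mod_cast (by lia)))
    have hB : ContDiffAt ℝ 2 (iteratedFDeriv ℝ j F) z :=
      hF.iteratedFDeriv_right (by norm_cast; lia)
    have hsymm := hB.isSymmSndFDerivAt (by simp)
    have hB' : DifferentiableAt ℝ (fderiv ℝ (iteratedFDeriv ℝ j F)) z :=
      (hB.fderiv_right (m := 1) (by norm_num)).differentiableAt (by simp)
    have : fderiv ℝ (fderiv ℝ (iteratedFDeriv ℝ j F)) z v =
        fderiv ℝ (fun y => fderiv ℝ (iteratedFDeriv ℝ j F) y v) z := by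
      ext1 w
      rw [fderiv_clm_apply hB' (differentiableAt_const v)]
      simp [hsymm.eq v w]
    have hB1 : DifferentiableAt ℝ (iteratedFDeriv ℝ (j + 1) F) z :=
      (hF.iteratedFDeriv_right (m := 1) (i := j + 1) (by norm_cast; lia)).differentiableAt
        (by simp)
    ext m
    rw [iteratedFDeriv_succ_apply_left, ← Filter.EventuallyEq.fderiv_eq hev, ← this,
      ← fderiv_continuousMultilinear_apply_const_apply hB1]
    simp only [iteratedFDeriv_succ_apply_left]
    rw [fderiv_continuousMultilinear_apply_const_apply
      (c := fun y => fderiv ℝ (iteratedFDeriv ℝ j F) y (m 0))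
      (hB'.clm_apply (differentiableAt_const _)), fderiv_clm_apply hB' (differentiableAt_const _)]
    simp

theorem iteratedFDeriv_slice (j : ℕ) {F : E × ℝ → G} {y : E} {ε : ℝ}
    (hF : ContDiffAt ℝ j F (y, ε)) :
    iteratedFDeriv ℝ j (fun y => F (y, ε)) y =
      (iteratedFDeriv ℝ j F (y, ε)).compContinuousLinearMap
        fun _ => ContinuousLinearMap.inl ℝ E ℝ := by
  induction j generalizing y with
  | zero => ext m; simp
  | succ j ih =>
    have hc : ContinuousAt (fun y : E => (y, ε)) y := by fun_prop
    have hev : (iteratedFDeriv ℝ j fun y => F (y, ε)) =ᶠ[𝓝 y] fun y =>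
        (iteratedFDeriv ℝ j F (y, ε)).compContinuousLinearMap
          fun _ => ContinuousLinearMap.inl ℝ E ℝ := by
      filter_upwards [hc.eventually (hF.eventually (natCast_ne_infty _))] with y' hy'
      exact ih (hy'.of_le (by exact_mod_cast (by lia)))
    have hd : DifferentiableAt ℝ (iteratedFDeriv ℝ j F) (y, ε) :=
      (hF.iteratedFDeriv_right (m := 1) (i := j) (by norm_cast; lia)).differentiableAt (by simp)
    have h1 : HasFDerivAt (fun y : E => (y, ε)) (ContinuousLinearMap.inl ℝ E ℝ) y :=
      hasFDerivAt_prodMk_left y ε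
    have h2 := hd.hasFDerivAt.comp y h1
    have h3 := ((ContinuousMultilinearMap.compContinuousLinearMapL (𝕜 := ℝ)
      (F := G) (fun _ : Fin j => ContinuousLinearMap.inl ℝ E ℝ)).hasFDerivAt).comp y h2
    ext m
    rw [iteratedFDeriv_succ_apply_left, hev.fderiv_eq]
    have h4 : HasFDerivAt (fun y => (iteratedFDeriv ℝ j F (y, ε)).compContinuousLinearMap
          fun _ => ContinuousLinearMap.inl ℝ E ℝ) _ y := h3
    rw [h4.fderiv]
    simp [iteratedFDeriv_succ_apply_left, Fin.tail_def]

/-- Iterated derivatives in `y` commute with the derivative by the parameter. -/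
theorem hasDerivAt_iteratedFDeriv_slice (j : ℕ) {F : E × ℝ → G} {y : E} {ε : ℝ}
    (hF : ContDiffAt ℝ (j + 2 : ℕ) F (y, ε)) :
    HasDerivAt (fun δ => iteratedFDeriv ℝ j (fun y => F (y, δ)) y)
      (iteratedFDeriv ℝ j (fun y => fderiv ℝ F (y, ε) (0, 1)) y) ε := by
  have hd : DifferentiableAt ℝ (iteratedFDeriv ℝ j F) (y, ε) :=
    (hF.iteratedFDeriv_right (m := 1) (i := j) (by norm_cast; lia)).differentiableAt (by simp)
  have hc : ContinuousAt (fun δ : ℝ => (y, δ)) ε := by fun_prop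
  have h2 : HasDerivAt (fun z : ℝ => (y, z)) ((0 : E), (1 : ℝ)) ε :=
    (hasDerivAt_const _ _).prodMk (hasDerivAt_id _)
  have h3 := hd.hasFDerivAt.comp_hasDerivAt ε h2
  have h4 := ((ContinuousMultilinearMap.compContinuousLinearMapL (𝕜 := ℝ)
      (F := G) (fun _ : Fin j => ContinuousLinearMap.inl ℝ E ℝ)).hasFDerivAt).comp_hasDerivAt ε h3
  rw [fderiv_iteratedFDeriv_apply j _ hF] at h4
  have h5 := iteratedFDeriv_slice j (F := fun w => fderiv ℝ F w (0, 1)) (y := y) (ε := ε)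
    ((hF.fderiv_right (m := j) (by norm_cast; lia)).clm_apply contDiffAt_const)
  rw [h5]
  refine HasDerivAt.congr_of_eventuallyEq h4 ?_
  filter_upwards [hc.eventually (hF.eventually (natCast_ne_infty _))] with δ hδ
  exact iteratedFDeriv_slice j (hδ.of_le (by exact_mod_cast (by lia)))

end IteratedDerivatives

/-- At a zero of `b` the product rule for `a * b` needs only continuity of `a`. -/
theorem hasDerivAt_mul_of_zero {a b : ℝ → ℝ} {b' t : ℝ} (ha : ContinuousAt a t)
    (hb : HasDerivAt b b' t) (h0 : b t = 0) : HasDerivAt (fun s => a s * b s) (a t * b') t := by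
  rw [hasDerivAt_iff_tendsto_slope] at hb ⊢
  have := (ha.tendsto.mono_left (nhdsWithin_le_nhds (s := {t}ᶜ))).mul hb
  refine this.congr fun s => ?_
  simp [slope_def_field, h0, mul_div_assoc]

/-! ### Smoothness and linearisation of ordinary differential equations -/

theorem contDiffAt_iteratedDeriv {n : ℕ∞ω} {m : ℕ∞ω} {i : ℕ} {φ : ℝ → ℝ} {t : ℝ}
    (hφ : ContDiffAt ℝ n φ t) (h : m + i ≤ n) : ContDiffAt ℝ m (iteratedDeriv i φ) t := by
  have h1 : ContDiffAt ℝ m (iteratedFDeriv ℝ i φ) t := hφ.iteratedFDeriv_right h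
  have h2 : iteratedDeriv i φ = fun s => iteratedFDeriv ℝ i φ s (fun _ => 1) := by
    ext s; rw [iteratedDeriv_eq_iteratedFDeriv]
  rw [h2]
  exact (ContinuousMultilinearMap.apply ℝ (fun _ : Fin i => ℝ) ℝ
    (fun _ => (1 : ℝ))).contDiff.contDiffAt.comp t h1

theorem eventually_contDiffAt {n : ℕ} {E : Type*} [NormedAddCommGroup E] [NormedSpace ℝ E]
    {f : E → ℝ} {x : E} (hf : ContDiffAt ℝ ∞ f x) : ∀ᶠ y in 𝓝 x, ContDiffAt ℝ n f y :=
  (hf.of_le (by exact_mod_cast le_top)).eventually (natCast_ne_infty n)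

theorem contDiffAt_succ_of_deriv {n : ℕ} {φ : ℝ → ℝ} {t : ℝ}
    (hd : ∀ᶠ s in 𝓝 t, DifferentiableAt ℝ φ s) (h : ContDiffAt ℝ n (deriv φ) t) :
    ContDiffAt ℝ (n + 1) φ t := by
  rw [contDiffAt_succ_iff_hasFDerivAt]
  refine ⟨fun s => ContinuousLinearMap.toSpanSingleton ℝ (deriv φ s), ⟨_, hd, fun s hs => ?_⟩, ?_⟩
  · exact hs.hasDerivAt.hasFDerivAt
  · exact (ContinuousLinearMap.toSpanSingletonCLE (𝕜 := ℝ) (E := ℝ)).contDiff.contDiffAt.comp t h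

theorem contDiffAt_of_iteratedDeriv {r n : ℕ} {φ : ℝ → ℝ} {t : ℝ} (hφ : ContDiffAt ℝ r φ t)
    (h : ContDiffAt ℝ n (iteratedDeriv r φ) t) : ContDiffAt ℝ (r + n : ℕ) φ t := by
  induction r generalizing φ with
  | zero => simpa using h
  | succ r ih =>
    have hev : ∀ᶠ s in 𝓝 t, DifferentiableAt ℝ φ s :=
      (hφ.eventually (natCast_ne_infty _)).mono fun s hs => hs.differentiableAt (by simp)
    have hd : ContDiffAt ℝ r (deriv φ) t := by
      have := contDiffAt_iteratedDeriv (m := r) (i := 1) hφ (by norm_cast)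
      rwa [iteratedDeriv_one] at this
    rw [iteratedDeriv_succ'] at h
    have := contDiffAt_succ_of_deriv hev (ih hd h)
    refine this.of_le ?_
    norm_cast
    lia

theorem contDiffAt_derivs {r : ℕ} {n m : ℕ∞ω} {φ : ℝ → ℝ} {t : ℝ} (hφ : ContDiffAt ℝ n φ t)
    (h : m + r ≤ n) : ContDiffAt ℝ m (derivs r φ) t := by
  refine contDiffAt_pi.2 fun j => contDiffAt_iteratedDeriv hφ (le_trans ?_ h)
  gcongr
  exact_mod_cast Fin.is_le j

/-- A solution of class `C^r` of an equation of order `r` is smooth: the implicit function theorem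
expresses the derivative of order `r` by the lower ones, so every step gains one derivative. -/
theorem ODE.contDiffAt_solution {r : ℕ} (R : ODE r) {φ : ℝ → ℝ} {t : ℝ}
    (hφ : ContDiffAt ℝ r φ t)
    (hdom : (t, derivs r φ t) ∈ R.dom)
    (hsol : ∀ᶠ s in 𝓝 t, R.eqn (s, derivs r φ s) = 0) : ContDiffAt ℝ ∞ φ t := by
  refine contDiffAt_infty.2 fun n => ?_
  suffices h : ∀ n : ℕ, ContDiffAt ℝ (r + n : ℕ) φ t from
    (h n).of_le (by exact_mod_cast Nat.le_add_left n r)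
  intro n
  induction n with
  | zero => simpa using hφ
  | succ n ih =>
    refine contDiffAt_of_iteratedDeriv hφ ?_
    -- `q` collects the derivatives of order less than `r`, with `0` in the place of the last one
    let q : ℝ → ℝ × (Fin (r + 1) → ℝ) := fun s =>
      (s, fun j => if j = Fin.last r then 0 else iteratedDeriv j φ s)
    let K : (ℝ × (Fin (r + 1) → ℝ)) × ℝ → ℝ := fun p =>
      R.eqn (p.1 + p.2 • (0, Pi.single (Fin.last r) 1))
    have hval : ∀ s, q s + iteratedDeriv r φ s • ((0 : ℝ), Pi.single (Fin.last r) (1 : ℝ)) =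
        (s, derivs r φ s) := by
      intro s
      refine Prod.ext (by simp [q]) (funext fun j => ?_)
      by_cases hj : j = Fin.last r
      · subst hj; simp [q, derivs]
      · simp [q, derivs, hj]
    have hq : ContDiffAt ℝ (n + 1 : ℕ) q t := by
      refine contDiffAt_id.prodMk (contDiffAt_pi.2 fun j => ?_)
      by_cases hj : j = Fin.last r
      · simp only [hj, if_true]; exact contDiffAt_const
      · simp only [hj, if_false]
        have : (j : ℕ) < r := Fin.val_lt_last hj
        exact contDiffAt_iteratedDeriv ih (by norm_cast; lia)
    have hR : ContDiffAt ℝ ∞ R.eqn (t, derivs r φ t) :=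
      R.smooth.contDiffAt (R.isOpen_dom.mem_nhds hdom)
    have hK : ContDiffAt ℝ ∞ K (q t, iteratedDeriv r φ t) := by
      refine ContDiffAt.comp _ (g := R.eqn) ?_ ?_
      · simpa only [hval] using hR
      · fun_prop
    refine contDiffAt_of_implicit (by simp) hq ?_ (hK.of_le (by exact_mod_cast le_top)) ?_
      (K := K) ?_
    · exact (contDiffAt_iteratedDeriv (m := 0) hφ (by simp)).continuousAt
    · have h1 : HasFDerivAt R.eqn (fderiv ℝ R.eqn (t, derivs r φ t))
          (q t + iteratedDeriv r φ t • ((0 : ℝ), Pi.single (Fin.last r) (1 : ℝ))) := by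
        rw [hval]; exact (hR.differentiableAt (by simp)).hasFDerivAt
      have h2 : HasDerivAt (fun z : ℝ => q t + z • ((0 : ℝ), Pi.single (Fin.last r) (1 : ℝ)))
          ((0 : ℝ), Pi.single (Fin.last r) (1 : ℝ)) (iteratedDeriv r φ t) := by
        simpa using ((hasDerivAt_id (iteratedDeriv r φ t)).smul_const
          ((0 : ℝ), (Pi.single (Fin.last r) (1 : ℝ) : Fin (r + 1) → ℝ))).const_add (q t)
      have h3 := h1.comp_hasDerivAt _ h2
      have h4 : HasDerivAt (fun z : ℝ => (q t, z)) (0, 1) (iteratedDeriv r φ t) :=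
        (hasDerivAt_const _ _).prodMk (hasDerivAt_id _)
      have h5 := (hK.differentiableAt (by simp)).hasFDerivAt.comp_hasDerivAt _ h4
      rw [h5.unique h3]
      exact R.order _ hdom hsol.self_of_nhds
    · filter_upwards [hsol] with s hs
      simpa only [K, hval] using hs

/-- A solution of a homogeneous linear equation of order `r` with bounded coefficients vanishes if
its first `r` derivatives, counted from order `0`, vanish at one point. -/
theorem eq_zero_of_linear_ode {r : ℕ} {a b C : ℝ} {c : Fin r → ℝ → ℝ} {χ : ℝ → ℝ}
    (hχ : ∀ t ∈ Ioo a b, ContDiffAt ℝ ∞ χ t) (hc : ∀ t ∈ Ioo a b, ∀ j, |c j t| ≤ C)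
    (hode : ∀ t ∈ Ioo a b, iteratedDeriv r χ t = ∑ j, c j t * iteratedDeriv j χ t)
    {t₁ : ℝ} (ht₁ : t₁ ∈ Ioo a b) (h0 : ∀ j : Fin r, iteratedDeriv j χ t₁ = 0) :
    ∀ t ∈ Ioo a b, χ t = 0 := by
  obtain rfl | hr := Nat.eq_zero_or_pos r
  · intro t ht
    simpa using hode t ht
  -- the equivalent first-order system
  let y : ℝ → Fin r → ℝ := fun t j => iteratedDeriv j χ t
  let v : ℝ → (Fin r → ℝ) → Fin r → ℝ := fun t z j =>
    if h : (j : ℕ) + 1 < r then z ⟨j + 1, h⟩ else ∑ i, c i t * z i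
  have hC : 0 ≤ C := (abs_nonneg _).trans (hc t₁ ht₁ ⟨0, hr⟩)
  have hlip : ∀ t ∈ Ioo a b, LipschitzOnWith (Real.toNNReal (1 + r * C)) (v t) univ := by
    intro t ht
    refine LipschitzOnWith.of_dist_le_mul fun z _ z' _ => ?_
    rw [Real.coe_toNNReal _ (by positivity)]
    have hz : ∀ i, |z i - z' i| ≤ dist z z' := fun i => by
      rw [← Real.dist_eq]; exact dist_le_pi_dist z z' i
    refine (dist_pi_le_iff (by positivity)).2 fun j => ?_
    rw [Real.dist_eq]
    by_cases h : (j : ℕ) + 1 < r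
    · simp only [v, h, dif_pos]
      refine (hz _).trans ?_
      have : 0 ≤ r * C * dist z z' := by positivity
      linarith
    · simp only [v, h, dif_neg, not_false_eq_true]
      rw [← Finset.sum_sub_distrib]
      calc |∑ i, (c i t * z i - c i t * z' i)| ≤ ∑ i, |c i t * z i - c i t * z' i| :=
            Finset.abs_sum_le_sum_abs _ _
        _ ≤ ∑ _i : Fin r, C * dist z z' := by
            refine Finset.sum_le_sum fun i _ => ?_
            rw [← mul_sub, abs_mul]
            exact mul_le_mul (hc t ht i) (hz i) (abs_nonneg _) hC
        _ = r * C * dist z z' := by simp [mul_assoc]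
        _ ≤ (1 + r * C) * dist z z' := by
            have : 0 ≤ dist z z' := dist_nonneg
            linarith
  have hy : ∀ t ∈ Ioo a b, HasDerivAt y (v t (y t)) t ∧ y t ∈ univ := by
    intro t ht
    refine ⟨hasDerivAt_pi.2 fun j => ?_, mem_univ _⟩
    have h1 : HasDerivAt (iteratedDeriv j χ) (iteratedDeriv (j + 1) χ t) t := by
      rw [iteratedDeriv_succ]
      exact ((contDiffAt_iteratedDeriv (m := 1) (hχ t ht)
        (by exact_mod_cast le_top)).differentiableAt (by simp)).hasDerivAt
    have h2 : v t (y t) j = iteratedDeriv (j + 1) χ t := by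
      by_cases h : (j : ℕ) + 1 < r
      · simp [v, h, y]
      · have hj : (j : ℕ) + 1 = r := by lia
        simp only [v, y, hj]
        simpa using (hode t ht).symm
    rw [h2]
    exact h1
  have hz : ∀ t ∈ Ioo a b, HasDerivAt (fun _ : ℝ => (0 : Fin r → ℝ)) (v t 0) t ∧
      (0 : Fin r → ℝ) ∈ univ := by
    intro t _
    refine ⟨?_, mem_univ _⟩
    have : v t 0 = 0 := by
      funext j
      simp [v]
    rw [this]
    exact hasDerivAt_const _ _
  have heq := ODE_solution_unique_of_mem_Ioo hlip ht₁ hy hz (funext h0)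
  intro t ht
  simpa [y] using congrFun (heq ht) ⟨0, hr⟩

/-- Near `t₀` the solutions of the equation linearised at `φ` are determined by `r` initial values
at any point. The neighbourhood `U` is where the leading coefficient is nonzero and the normalised
coefficients are bounded; it does not depend on the solution. -/
theorem ODE.exists_nhds_linearized_unique {r : ℕ} (R : ODE r) {φ : ℝ → ℝ} {t₀ : ℝ}
    (hφ : ContDiffAt ℝ ∞ φ t₀) (hdom : (t₀, derivs r φ t₀) ∈ R.dom)
    (hsol : R.eqn (t₀, derivs r φ t₀) = 0) :
    ∃ U ∈ 𝓝 t₀, ∀ a b, Ioo a b ⊆ U → ∀ χ : ℝ → ℝ,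
      (∀ t ∈ Ioo a b, ContDiffAt ℝ ∞ χ t ∧
        fderiv ℝ R.eqn (t, derivs r φ t) (0, derivs r χ t) = 0) →
      ∀ t₁ ∈ Ioo a b, (∀ j : Fin r, iteratedDeriv j χ t₁ = 0) → ∀ t ∈ Ioo a b, χ t = 0 := by
  let A : Fin (r + 1) → ℝ → ℝ := fun j t =>
    fderiv ℝ R.eqn (t, derivs r φ t) (0, Pi.single j 1)
  have hR : ContDiffAt ℝ ∞ R.eqn (t₀, derivs r φ t₀) :=
    R.smooth.contDiffAt (R.isOpen_dom.mem_nhds hdom)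
  have hA : ∀ j, ContinuousAt (A j) t₀ := by
    intro j
    have h1 : ContinuousAt (fun t => (t, derivs r φ t)) t₀ :=
      continuousAt_id.prodMk
        (contDiffAt_derivs (m := 0) hφ (by exact_mod_cast le_top)).continuousAt
    have h2 : ContinuousAt (fderiv ℝ R.eqn) (t₀, derivs r φ t₀) :=
      (hR.fderiv_right (m := 0) (by simp)).continuousAt
    exact (ContinuousAt.comp (f := fun t => (t, derivs r φ t)) h2 h1).clm_apply
      continuousAt_const
  have hAl : A (Fin.last r) t₀ ≠ 0 := R.order _ hdom hsol
  let c : Fin r → ℝ → ℝ := fun j t => -(A j.castSucc t / A (Fin.last r) t)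
  have hc : ∀ j, ContinuousAt (c j) t₀ := fun j => ((hA _).div (hA _) hAl).neg
  have hb : ∀ j : Fin r, ∀ᶠ t in 𝓝 t₀, |c j t| ≤ (∑ j, |c j t₀|) + 1 := by
    intro j
    have h1 : |c j t₀| < (∑ j, |c j t₀|) + 1 := by
      have := Finset.single_le_sum (f := fun j => |c j t₀|) (fun i _ => abs_nonneg _)
        (Finset.mem_univ j)
      linarith
    exact ((hc j).abs.eventually (gt_mem_nhds h1)).mono fun t ht => ht.le
  refine ⟨_, (eventually_all.2 hb).and ((hA _).eventually_ne hAl), ?_⟩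
  intro a b hab χ hχ t₁ ht₁ h0
  refine eq_zero_of_linear_ode (fun t ht => (hχ t ht).1) (fun t ht => (hab ht).1) ?_ ht₁ h0
  intro t ht
  have hne : A (Fin.last r) t ≠ 0 := (hab ht).2
  have hlin := (hχ t ht).2
  have hsum : ((0 : ℝ), derivs r χ t) =
      ∑ j : Fin (r + 1), iteratedDeriv j χ t • ((0 : ℝ), (Pi.single j 1 : Fin (r + 1) → ℝ)) := by
    refine Prod.ext (by simp [Prod.fst_sum]) ?_
    rw [Prod.snd_sum]
    funext i
    simp [derivs, Finset.sum_apply, Pi.single_apply]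
  rw [hsum, map_sum] at hlin
  simp only [map_smul, smul_eq_mul] at hlin
  rw [Fin.sum_univ_castSucc] at hlin
  change ∑ j : Fin r, iteratedDeriv j χ t * A j.castSucc t +
    iteratedDeriv r χ t * A (Fin.last r) t = 0 at hlin
  have h1 : ∑ j : Fin r, c j t * iteratedDeriv j χ t =
      -(∑ j : Fin r, iteratedDeriv j χ t * A j.castSucc t) / A (Fin.last r) t := by
    rw [neg_div, Finset.sum_div, ← Finset.sum_neg_distrib]
    refine Finset.sum_congr rfl fun j _ => ?_
    simp only [c]
    ring
  rw [h1, eq_div_iff hne]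
  linarith

/-! ### Jets and the linearised equations -/

section Graph

variable {n : ℕ} {f : Base n → ℝ} {x : Base n}

theorem hasFDerivAt_graph (hf : DifferentiableAt ℝ f x) :
    HasFDerivAt (fun y => (y, f y)) ((ContinuousLinearMap.id ℝ (Base n)).prod (fderiv ℝ f x)) x :=
  (hasFDerivAt_id x).prodMk hf.hasFDerivAt

/-- A linear form that vanishes on the graph of `f'` is determined by its value on `∂_u`. -/
theorem apply_eq_of_forall_graph_eq_zero {a : Pt n →L[ℝ] ℝ} {f' : Base n →L[ℝ] ℝ}
    (ha : ∀ v, a (v, f' v) = 0) (r : Base n) (s : ℝ) : a (r, s) = (s - f' r) * a (0, 1) := by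
  have h : ((r, s) : Pt n) = (r, f' r) + (s - f' r) • (0, 1) := by
    ext <;> simp
  rw [h, map_add, ha, map_smul, smul_eq_mul, zero_add]

theorem eq_zero_of_forall_graph_eq_zero {a : Pt n →L[ℝ] ℝ} {f' : Base n →L[ℝ] ℝ}
    (ha : ∀ v, a (v, f' v) = 0) (h1 : a (0, 1) = 0) : a = 0 := by
  refine ContinuousLinearMap.ext fun p => ?_
  rw [← Prod.mk.eta (p := p), apply_eq_of_forall_graph_eq_zero ha, h1, mul_zero]
  rfl

end Graph

section Jets

variable {n k : ℕ} {ι : Type}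

theorem hasFDerivAt_jet {f : Base n → ℝ} {x : Base n} (hf : ContDiffAt ℝ ∞ f x) :
    HasFDerivAt (jet k f) ((ContinuousLinearMap.id ℝ (Base n)).prod
      (ContinuousLinearMap.pi fun j : Fin (k + 1) => fderiv ℝ (iteratedFDeriv ℝ (j : ℕ) f) x))
      x := by
  refine (hasFDerivAt_id x).prodMk (hasFDerivAt_pi.2 fun j => ?_)
  exact ((hf.iteratedFDeriv_right (m := 1) (i := j)
    (by exact_mod_cast le_top)).differentiableAt (by simp)).hasFDerivAt

/-- The characteristic of a symmetry along a solution solves the linearised system: the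
prolongation is the jet of the characteristic plus the derivative of the jet of `f` along `ξ`, and
the latter is tangent to the set of jets where the equations hold. -/
theorem DiffSystem.IsInvariant.fderiv_jet_characteristic {S : DiffSystem n k ι} {D : Set (Pt n)}
    {X : VField n} (h : S.IsInvariant D X) {f : Base n → ℝ} {x : Base n}
    (hf : ContDiffAt ℝ ∞ f x) (hxD : (x, f x) ∈ D) (hsol : ∀ᶠ y in 𝓝 x, S.Holds (jet k f y))
    (i : ι) (hd : DifferentiableAt ℝ (S.eqn i) (jet k f x)) :
    fderiv ℝ (S.eqn i) (jet k f x)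
      (0, fun j : Fin (k + 1) => iteratedFDeriv ℝ (j : ℕ) (characteristic X f) x) = 0 := by
  have h1 := h f x hf hxD hsol.self_of_nhds i
  have h2 := hd.hasFDerivAt.comp x (hasFDerivAt_jet (k := k) hf)
  have h3 : HasFDerivAt (S.eqn i ∘ jet k f) (0 : Base n →L[ℝ] ℝ) x :=
    (hasFDerivAt_const (0 : ℝ) x).congr_of_eventuallyEq (hsol.mono fun y hy => hy.2 i)
  have h4 := DFunLike.congr_fun (h2.unique h3) (X (x, f x)).1
  have h5 : prolong k X f x =
      ((0, fun j : Fin (k + 1) => iteratedFDeriv ℝ (j : ℕ) (characteristic X f) x) : Jet n k) +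
        ((ContinuousLinearMap.id ℝ (Base n)).prod (ContinuousLinearMap.pi fun j : Fin (k + 1) =>
          fderiv ℝ (iteratedFDeriv ℝ (j : ℕ) f) x)) (X (x, f x)).1 := by
    refine Prod.ext ?_ ?_
    · simp [prolong]
    · funext j
      simp [prolong]
  rw [h5, map_add] at h1
  have h6 : fderiv ℝ (S.eqn i) (jet k f x) (((ContinuousLinearMap.id ℝ (Base n)).prod
      (ContinuousLinearMap.pi fun j : Fin (k + 1) =>
          fderiv ℝ (iteratedFDeriv ℝ (j : ℕ) f) x)) (X (x, f x)).1) = 0 := h4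
  rwa [h6, add_zero] at h1

theorem contDiffAt_characteristic {X : VField n} {f : Base n → ℝ} {x : Base n}
    (hX : ContDiffAt ℝ ∞ X (x, f x)) (hf : ContDiffAt ℝ ∞ f x) :
    ContDiffAt ℝ ∞ (characteristic X f) x := by
  have h1 : ContDiffAt ℝ ∞ (fun y => X (y, f y)) x :=
    ContDiffAt.comp x (f := fun y => (y, f y)) hX (contDiffAt_id.prodMk hf)
  have h2 : ContDiffAt ℝ ∞ (fderiv ℝ f) x := hf.fderiv_right (by simp)
  exact h1.snd.sub (h2.clm_apply h1.fst)

theorem differentiableAt_invariantSurfaceSystem {m : ℕ} {D : Set (Pt n)} {Q : Fin m → VField n}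
    {a : Fin m} {J : Jet n 1} (hQ : DifferentiableAt ℝ (Q a) J.point) :
    DifferentiableAt ℝ ((invariantSurfaceSystem D Q).eqn a) J := by
  have hpt : DifferentiableAt ℝ (fun J : Jet n 1 => J.point) J := by
    refine differentiableAt_fst.prodMk ?_
    have h0 : DifferentiableAt ℝ (fun J : Jet n 1 => J.2 0) J := by fun_prop
    exact (ContinuousMultilinearMap.apply ℝ (fun _ : Fin ((0 : Fin 2) : ℕ) => Base n) ℝ
      (fun _ => (0 : Base n))).differentiableAt.comp J h0
  have hQJ : DifferentiableAt ℝ (fun J : Jet n 1 => Q a J.point) J :=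
    DifferentiableAt.comp (f := fun J : Jet n 1 => J.point) J hQ hpt
  refine hQJ.snd.sub ?_
  have h1 : DifferentiableAt ℝ
      (fun J : Jet n 1 => continuousMultilinearCurryFin1 ℝ (Base n) ℝ (J.2 1)) J := by
    have h0 : DifferentiableAt ℝ (fun J : Jet n 1 => J.2 1) J := by fun_prop
    exact (continuousMultilinearCurryFin1 ℝ (Base n)
      ℝ).toContinuousLinearEquiv.differentiableAt.comp J h0
  have h2 : (fun J : Jet n 1 => J.2 1 (fun _ => (Q a J.point).1)) = fun J : Jet n 1 =>
      continuousMultilinearCurryFin1 ℝ (Base n) ℝ (J.2 1) (Q a J.point).1 := by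
    funext J
    rw [continuousMultilinearCurryFin1_apply]
    congr 1
  rw [h2]
  exact h1.clm_apply hQJ.fst

/-- The first-order system linearised at `f`, for the characteristic of one of its symmetries. -/
theorem fderiv_characteristic_eq {m : ℕ} {D : Set (Pt n)} {Q : Fin m → VField n} {X : VField n}
    (hXQ : (invariantSurfaceSystem D Q).IsInvariant D X) {a : Fin m} {f : Base n → ℝ} {x : Base n}
    (hQ : DifferentiableAt ℝ (Q a) (x, f x))
    (hf : ContDiffAt ℝ ∞ f x) (hxD : (x, f x) ∈ D)
    (hsol : ∀ᶠ y in 𝓝 x, (invariantSurfaceSystem D Q).Holds (jet 1 f y)) :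
    fderiv ℝ (characteristic X f) x (Q a (x, f x)).1 =
      ((fderiv ℝ (Q a) (x, f x) (0, 1)).2 - fderiv ℝ f x (fderiv ℝ (Q a) (x, f x) (0, 1)).1) *
        characteristic X f x := by
  set g := characteristic X f
  have hpt : (jet 1 f x).point = (x, f x) := by simp [Jet.point, jet]
  have hd : DifferentiableAt ℝ ((invariantSurfaceSystem D Q).eqn a) (jet 1 f x) :=
    differentiableAt_invariantSurfaceSystem (by rwa [hpt])
  have h0 := hXQ.fderiv_jet_characteristic hf hxD hsol a hd
  set V : Jet n 1 := (0, fun j : Fin 2 => iteratedFDeriv ℝ (j : ℕ) g x)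
  have hc : HasDerivAt (fun s : ℝ => jet 1 f x + s • V) V 0 := by
    simpa using ((hasDerivAt_id (0 : ℝ)).smul_const V).const_add (jet 1 f x)
  have hd' : HasFDerivAt ((invariantSurfaceSystem D Q).eqn a)
      (fderiv ℝ ((invariantSurfaceSystem D Q).eqn a) (jet 1 f x)) (jet 1 f x + (0 : ℝ) • V) := by
    simpa using hd.hasFDerivAt
  have h1 := hd'.comp_hasDerivAt (0 : ℝ) hc
  rw [h0] at h1
  have hu : HasDerivAt (fun s : ℝ => ((x, f x + s * g x) : Pt n)) (0, g x) 0 := by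
    refine (hasDerivAt_const _ _).prodMk ?_
    simpa using ((hasDerivAt_id (0 : ℝ)).mul_const (g x)).const_add (f x)
  have hQ' : HasFDerivAt (Q a) (fderiv ℝ (Q a) (x, f x)) (x, f x + (0 : ℝ) * g x) := by
    simpa using hQ.hasFDerivAt
  have h2 := hQ'.comp_hasDerivAt (0 : ℝ) hu
  have h3 : HasDerivAt (fun s : ℝ => fderiv ℝ f x + s • fderiv ℝ g x) (fderiv ℝ g x) 0 := by
    simpa using ((hasDerivAt_id (0 : ℝ)).smul_const (fderiv ℝ g x)).const_add (fderiv ℝ f x)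
  have h2₁ : HasDerivAt (fun s : ℝ => (Q a (x, f x + s * g x)).1)
      (fderiv ℝ (Q a) (x, f x) (0, g x)).1 0 :=
    (ContinuousLinearMap.fst ℝ (Base n) ℝ).hasFDerivAt.comp_hasDerivAt (0 : ℝ) h2
  have h2₂ : HasDerivAt (fun s : ℝ => (Q a (x, f x + s * g x)).2)
      (fderiv ℝ (Q a) (x, f x) (0, g x)).2 0 :=
    (ContinuousLinearMap.snd ℝ (Base n) ℝ).hasFDerivAt.comp_hasDerivAt (0 : ℝ) h2
  have h4 := h2₂.sub (h3.clm_apply h2₁)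
  have h5 : (fun s : ℝ => (invariantSurfaceSystem D Q).eqn a (jet 1 f x + s • V)) = fun s =>
      (Q a (x, f x + s * g x)).2 - (fderiv ℝ f x + s • fderiv ℝ g x)
        (Q a (x, f x + s * g x)).1 := by
    funext s
    have e1 : (jet 1 f x + s • V).point = (x, f x + s * g x) := by
      simp [Jet.point, jet, V]
    change (Q a (jet 1 f x + s • V).point).2 -
      (jet 1 f x + s • V).2 1 (fun _ => (Q a (jet 1 f x + s • V).point).1) = _
    rw [e1]
    simp only [jet, V, Prod.snd_add, Prod.smul_snd, Pi.add_apply, Pi.smul_apply,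
      add_apply, smul_apply]
    have e2 : ∀ (F : Base n → ℝ) (w : Base n),
        iteratedFDeriv ℝ ((1 : Fin 2) : ℕ) F x (fun _ => w) = fderiv ℝ F x w := fun F w =>
      iteratedFDeriv_one_apply _
    rw [e2, e2]
  have h6 := h1.unique (by
    change HasDerivAt (fun s : ℝ => (invariantSurfaceSystem D Q).eqn a (jet 1 f x + s • V)) _ 0
    rw [h5]
    exact h4)
  have h7 : ((0, g x) : Pt n) = g x • (0, 1) := by simp
  simp only [zero_mul, add_zero, zero_smul, h7, map_smul, Prod.smul_fst,
    Prod.smul_snd, smul_eq_mul] at h6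
  linarith

end Jets

/-! ### The ansatz along the graph of a solution -/

/-- The function `ζ - φ ∘ τ`, whose zero set is the family of graphs described by the ansatz. -/
def ansatzDefect {n : ℕ} (τ ζ : Pt n → ℝ) (φ : ℝ → ℝ) : Pt n → ℝ := fun p => ζ p - φ (τ p)

/-- The derivative of `ζ - φ ∘ τ` by `u` at the point of the graph of `f` over `x`. -/
noncomputable def ansatzWeight {n : ℕ} (τ ζ : Pt n → ℝ) (φ : ℝ → ℝ) (f : Base n → ℝ)
    (x : Base n) : ℝ :=
  fderiv ℝ (ansatzDefect τ ζ φ) (x, f x) (0, 1)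

/-- Near `x` the function `f` is given by the ansatz with `φ`, and both are smooth there. -/
structure IsSmoothAnsatzAt {n : ℕ} (τ ζ : Pt n → ℝ) (φ : ℝ → ℝ) (f : Base n → ℝ) (x : Base n) :
    Prop where
  smooth : ContDiffAt ℝ ∞ f x
  smooth_profile : ContDiffAt ℝ ∞ φ (τ (x, f x))
  form : HasAnsatzForm τ ζ φ f x

section

variable {n m : ℕ} {D : Set (Pt n)} {Q : Fin m → VField n} {τ ζ : Pt n → ℝ} {φ : ℝ → ℝ}
  {f : Base n → ℝ} {x : Base n}

theorem IsAnsatz.contDiffAt_τ (hA : IsAnsatz D Q τ ζ) (hD : IsOpen D) {p : Pt n} (hp : p ∈ D) :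
    ContDiffAt ℝ ∞ τ p := hA.smooth_τ.contDiffAt (hD.mem_nhds hp)

theorem IsAnsatz.contDiffAt_ζ (hA : IsAnsatz D Q τ ζ) (hD : IsOpen D) {p : Pt n} (hp : p ∈ D) :
    ContDiffAt ℝ ∞ ζ p := hA.smooth_ζ.contDiffAt (hD.mem_nhds hp)

theorem IsAnsatz.contDiffAt_ansatzDefect (hA : IsAnsatz D Q τ ζ) (hD : IsOpen D) {p : Pt n}
    (hp : p ∈ D) {r : ℕ∞ω} (hr : r ≤ ∞) (hφ : ContDiffAt ℝ r φ (τ p)) :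
    ContDiffAt ℝ r (ansatzDefect τ ζ φ) p :=
  ((hA.contDiffAt_ζ hD hp).of_le hr).sub (hφ.comp p ((hA.contDiffAt_τ hD hp).of_le hr))

theorem IsAnsatz.fderiv_ansatzDefect (hA : IsAnsatz D Q τ ζ) (hD : IsOpen D) {p : Pt n}
    (hp : p ∈ D) (hφ : DifferentiableAt ℝ φ (τ p)) :
    fderiv ℝ (ansatzDefect τ ζ φ) p = fderiv ℝ ζ p - deriv φ (τ p) • fderiv ℝ τ p := by
  have h1 := ((hA.contDiffAt_ζ hD hp).differentiableAt (by simp)).hasFDerivAt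
  have h2 := ((hA.contDiffAt_τ hD hp).differentiableAt (by simp)).hasFDerivAt
  exact (h1.sub (hφ.hasDerivAt.comp_hasFDerivAt p h2)).fderiv

/-- `ζ - φ ∘ τ` vanishes on the graph of `f`, so its derivative vanishes on the tangent space. -/
theorem IsAnsatz.fderiv_ansatzDefect_graph (hA : IsAnsatz D Q τ ζ) (hD : IsOpen D)
    (hxD : (x, f x) ∈ D) (hf : DifferentiableAt ℝ f x) (hφ : DifferentiableAt ℝ φ (τ (x, f x)))
    (hform : HasAnsatzForm τ ζ φ f x) (v : Base n) :
    fderiv ℝ (ansatzDefect τ ζ φ) (x, f x) (v, fderiv ℝ f x v) = 0 := by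
  have h1 : DifferentiableAt ℝ (ansatzDefect τ ζ φ) (x, f x) :=
    ((hA.contDiffAt_ζ hD hxD).differentiableAt (by simp)).sub
      (hφ.comp _ ((hA.contDiffAt_τ hD hxD).differentiableAt (by simp)))
  have h2 := HasFDerivAt.comp x (f := fun y => (y, f y)) h1.hasFDerivAt (hasFDerivAt_graph hf)
  have h3 : HasFDerivAt (ansatzDefect τ ζ φ ∘ fun y => (y, f y)) (0 : Base n →L[ℝ] ℝ) x :=
    (hasFDerivAt_const (0 : ℝ) x).congr_of_eventuallyEq
      (hform.mono fun y hy => sub_eq_zero.2 hy)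
  exact DFunLike.congr_fun (h2.unique h3) v

theorem IsAnsatz.ansatzWeight_ne_zero (hA : IsAnsatz D Q τ ζ) (hD : IsOpen D)
    (hxD : (x, f x) ∈ D) (hf : DifferentiableAt ℝ f x) (hφ : DifferentiableAt ℝ φ (τ (x, f x)))
    (hform : HasAnsatzForm τ ζ φ f x) : ansatzWeight τ ζ φ f x ≠ 0 := by
  intro h0
  have h1 := eq_zero_of_forall_graph_eq_zero
    (hA.fderiv_ansatzDefect_graph hD hxD hf hφ hform) h0
  rw [hA.fderiv_ansatzDefect hD hxD hφ] at h1
  have h2 := LinearIndependent.pair_iff.1 (hA.independent _ hxD) (-deriv φ (τ (x, f x))) 1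
    (by rw [← h1]; module)
  exact one_ne_zero h2.2

theorem IsAnsatz.fderiv_comp_graph_apply (hA : IsAnsatz D Q τ ζ) (hD : IsOpen D)
    (hxD : (x, f x) ∈ D) (hf : DifferentiableAt ℝ f x) (v : Base n) :
    fderiv ℝ (fun y => τ (y, f y)) x v = fderiv ℝ τ (x, f x) (v, fderiv ℝ f x v) := by
  have h2 := HasFDerivAt.comp x (f := fun y => (y, f y))
    ((hA.contDiffAt_τ hD hxD).differentiableAt (by simp)).hasFDerivAt (hasFDerivAt_graph hf)
  have h3 : HasFDerivAt (fun y => τ (y, f y)) _ x := h2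
  rw [h3.fderiv]
  rfl

theorem IsAnsatz.fderiv_comp_graph_ne_zero (hA : IsAnsatz D Q τ ζ) (hD : IsOpen D)
    (hxD : (x, f x) ∈ D) (hf : DifferentiableAt ℝ f x) (hφ : DifferentiableAt ℝ φ (τ (x, f x)))
    (hform : HasAnsatzForm τ ζ φ f x) : fderiv ℝ (fun y => τ (y, f y)) x ≠ 0 := by
  intro h0
  have hτ : ∀ v, fderiv ℝ τ (x, f x) (v, fderiv ℝ f x v) = 0 := fun v => by
    rw [← hA.fderiv_comp_graph_apply hD hxD hf, h0]; rfl
  have hζ : ∀ v, fderiv ℝ ζ (x, f x) (v, fderiv ℝ f x v) = 0 := fun v => by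
    have := hA.fderiv_ansatzDefect_graph hD hxD hf hφ hform v
    rw [hA.fderiv_ansatzDefect hD hxD hφ] at this
    simpa [hτ v] using this
  have h1 := eq_zero_of_forall_graph_eq_zero (f' := fderiv ℝ f x)
    (a := fderiv ℝ ζ (x, f x) (0, 1) • fderiv ℝ τ (x, f x) -
      fderiv ℝ τ (x, f x) (0, 1) • fderiv ℝ ζ (x, f x))
    (fun v => by simp [hτ, hζ]) (by simp [mul_comm])
  have h2 := LinearIndependent.pair_iff.1 (hA.independent _ hxD)
    (fderiv ℝ ζ (x, f x) (0, 1)) (-fderiv ℝ τ (x, f x) (0, 1)) (by rw [← h1]; module)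
  have h3 := eq_zero_of_forall_graph_eq_zero hτ (neg_eq_zero.1 h2.2)
  exact (hA.independent _ hxD).ne_zero 0 h3

/-- The vectors `ξ_a` span the kernel of the derivative of `x ↦ τ (x, f x)`: they lie in it, and
both spaces have dimension `n - 1`. -/
theorem IsAnsatz.ker_le_span (hA : IsAnsatz D Q τ ζ) (hD : IsOpen D)
    (hxD : (x, f x) ∈ D) (hf : DifferentiableAt ℝ f x) (hφ : DifferentiableAt ℝ φ (τ (x, f x)))
    (hform : HasAnsatzForm τ ζ φ f x)
    (hsol : ∀ a, fderiv ℝ f x (Q a (x, f x)).1 = (Q a (x, f x)).2) {v : Base n}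
    (hv : fderiv ℝ (fun y => τ (y, f y)) x v = 0) :
    v ∈ Submodule.span ℝ (range fun a => (Q a (x, f x)).1) := by
  set L : Base n →ₗ[ℝ] ℝ := (fderiv ℝ (fun y => τ (y, f y)) x : Base n →ₗ[ℝ] ℝ)
  have hne := hA.fderiv_comp_graph_ne_zero hD hxD hf hφ hform
  have hle : Submodule.span ℝ (range fun a => (Q a (x, f x)).1) ≤ LinearMap.ker L := by
    rw [Submodule.span_le]
    rintro _ ⟨a, rfl⟩
    change fderiv ℝ (fun y => τ (y, f y)) x _ = 0
    rw [hA.fderiv_comp_graph_apply hD hxD hf, hsol]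
    exact hA.invariant_τ a _ hxD
  have hsurj : Function.Surjective L :=
    LinearMap.surjective fun h => hne (ContinuousLinearMap.coe_injective h)
  have h1 := LinearMap.finrank_range_add_finrank_ker L
  rw [LinearMap.range_eq_top.2 hsurj, finrank_top, Module.finrank_self,
    finrank_euclideanSpace_fin] at h1
  have h2 := hA.rank _ hxD
  rw [add_comm] at h1
  have h3 := Submodule.eq_of_le_of_finrank_eq hle (Nat.succ_injective (h2.trans h1.symm))
  rw [h3]
  exact hv

/-- The characteristic of `X`, multiplied by the weight, is constant to first order along the
level sets of `x ↦ τ (x, f x)`: the logarithmic derivatives of the two factors in the direction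
`ξ_a` cancel. For the characteristic this derivative is given by the linearised first-order system,
for the weight by differentiating `Q_a (ζ - φ ∘ τ) = 0` by `u`. -/
theorem IsAnsatz.fderiv_weight_mul_characteristic (hA : IsAnsatz D Q τ ζ) (hD : IsOpen D)
    (hQ : ∀ a, ContDiffOn ℝ ∞ (Q a) D) {X : VField n} (hX : ContDiffOn ℝ ∞ X D)
    (hXQ : (invariantSurfaceSystem D Q).IsInvariant D X) (hxD : (x, f x) ∈ D)
    (hx : IsSmoothAnsatzAt τ ζ φ f x)
    (hsol : ∀ᶠ y in 𝓝 x, (invariantSurfaceSystem D Q).Holds (jet 1 f y)) {v : Base n}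
    (hv : fderiv ℝ (fun y => τ (y, f y)) x v = 0) :
    fderiv ℝ (fun y => ansatzWeight τ ζ φ f y * characteristic X f y) x v = 0 := by
  have hfd : DifferentiableAt ℝ f x := hx.smooth.differentiableAt (by simp)
  have hφd : DifferentiableAt ℝ φ (τ (x, f x)) := hx.smooth_profile.differentiableAt (by simp)
  have hsurf : ∀ a, fderiv ℝ f x (Q a (x, f x)).1 = (Q a (x, f x)).2 := by
    intro a
    have h1 := hsol.self_of_nhds.2 a
    have hpt : (jet 1 f x).point = (x, f x) := by simp [Jet.point, jet]
    change (Q a (jet 1 f x).point).2 - (jet 1 f x).2 1 (fun _ => (Q a (jet 1 f x).point).1) = 0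
      at h1
    rw [hpt] at h1
    have h2 : (jet 1 f x).2 1 (fun _ => (Q a (x, f x)).1) =
      fderiv ℝ f x (Q a (x, f x)).1 := iteratedFDeriv_one_apply _
    rw [h2] at h1
    linarith
  suffices hle : Submodule.span ℝ (range fun a => (Q a (x, f x)).1) ≤
      LinearMap.ker (fderiv ℝ (fun y => ansatzWeight τ ζ φ f y * characteristic X f y) x :
        Base n →ₗ[ℝ] ℝ) from
    hle (hA.ker_le_span hD hxD hfd hφd hx.form hsurf hv)
  rw [Submodule.span_le]
  rintro _ ⟨a, rfl⟩
  change fderiv ℝ (fun y => ansatzWeight τ ζ φ f y * characteristic X f y) x _ = 0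
  have hG : ContDiffAt ℝ ∞ (ansatzDefect τ ζ φ) (x, f x) :=
    hA.contDiffAt_ansatzDefect hD hxD le_rfl hx.smooth_profile
  have hG' : DifferentiableAt ℝ (fderiv ℝ (ansatzDefect τ ζ φ)) (x, f x) :=
    (hG.fderiv_right (m := ∞) (by simp)).differentiableAt (by simp)
  have hQa : DifferentiableAt ℝ (Q a) (x, f x) :=
    ((hQ a).contDiffAt (hD.mem_nhds hxD)).differentiableAt (by simp)
  -- the derivative of the weight along the graph
  have hw : HasFDerivAt (ansatzWeight τ ζ φ f) _ x :=
    HasFDerivAt.comp x (f := fun y => (y, f y))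
      (hG'.hasFDerivAt.clm_apply (hasFDerivAt_const ((0, 1) : Pt n) (x, f x)))
      (hasFDerivAt_graph hfd)
  have hgd : HasFDerivAt (characteristic X f) _ x :=
    ((contDiffAt_characteristic (hX.contDiffAt (hD.mem_nhds hxD)) hx.smooth).differentiableAt
      (by simp)).hasFDerivAt
  have hwv : ∀ v, fderiv ℝ (ansatzWeight τ ζ φ f) x v =
      fderiv ℝ (fderiv ℝ (ansatzDefect τ ζ φ)) (x, f x) (v, fderiv ℝ f x v) (0, 1) := by
    intro v
    rw [hw.fderiv]
    simp
  -- the family annihilates `ζ - φ ∘ τ`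
  have hφev : ∀ᶠ p in 𝓝 (x, f x), DifferentiableAt ℝ φ (τ p) :=
    (hA.contDiffAt_τ hD hxD).continuousAt.eventually
      ((eventually_contDiffAt (n := 1) hx.smooth_profile).mono fun t ht =>
        ht.differentiableAt (by simp))
  have hQG : ∀ᶠ p in 𝓝 (x, f x), fderiv ℝ (ansatzDefect τ ζ φ) p (Q a p) = 0 := by
    filter_upwards [hφev, hD.mem_nhds hxD] with p hp hpD
    rw [hA.fderiv_ansatzDefect hD hpD hp]
    simp [hA.invariant_τ a p hpD, hA.invariant_ζ a p hpD]
  have hQG' := hG'.hasFDerivAt.clm_apply hQa.hasFDerivAt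
  have hQG0 : HasFDerivAt (fun p => fderiv ℝ (ansatzDefect τ ζ φ) p (Q a p))
      (0 : Pt n →L[ℝ] ℝ) (x, f x) :=
    (hasFDerivAt_const (0 : ℝ) _).congr_of_eventuallyEq hQG
  have h1 := DFunLike.congr_fun (hQG'.unique hQG0) (0, 1)
  have hsymm := (hG.isSymmSndFDerivAt
    (by simpa using WithTop.coe_le_coe.2 (le_top : (2 : ℕ∞) ≤ ⊤))).eq (0, 1) (Q a (x, f x))
  have h2 : fderiv ℝ (fderiv ℝ (ansatzDefect τ ζ φ)) (x, f x) (0, 1) (Q a (x, f x)) +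
      fderiv ℝ (ansatzDefect τ ζ φ) (x, f x) (fderiv ℝ (Q a) (x, f x) (0, 1)) = 0 := by
    simpa [add_comm] using h1
  have h3 := apply_eq_of_forall_graph_eq_zero
    (hA.fderiv_ansatzDefect_graph hD hxD hfd hφd hx.form)
    (fderiv ℝ (Q a) (x, f x) (0, 1)).1 (fderiv ℝ (Q a) (x, f x) (0, 1)).2
  rw [Prod.mk.eta] at h3
  have h4 := hwv (Q a (x, f x)).1
  rw [hsurf, Prod.mk.eta, ← hsymm] at h4
  have h5 := fderiv_characteristic_eq hXQ hQa hx.smooth hxD hsol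
  have h6 : fderiv ℝ (fun y => ansatzWeight τ ζ φ f y * characteristic X f y) x
      (Q a (x, f x)).1 = ansatzWeight τ ζ φ f x *
        fderiv ℝ (characteristic X f) x (Q a (x, f x)).1 + characteristic X f x *
        fderiv ℝ (ansatzWeight τ ζ φ f) x (Q a (x, f x)).1 := by
    rw [fderiv_fun_mul hw.differentiableAt hgd.differentiableAt]
    simp
  rw [h6, h5, h4]
  have h7 : fderiv ℝ (ansatzDefect τ ζ φ) (x, f x) (0, 1) = ansatzWeight τ ζ φ f x := rfl
  rw [h7] at h3
  linear_combination characteristic X f x * h2 - characteristic X f x * h3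

theorem IsAnsatz.contDiffAt_ansatzWeight (hA : IsAnsatz D Q τ ζ) (hD : IsOpen D)
    (hxD : (x, f x) ∈ D) (hx : IsSmoothAnsatzAt τ ζ φ f x) :
    ContDiffAt ℝ ∞ (ansatzWeight τ ζ φ f) x := by
  have hG : ContDiffAt ℝ ∞ (ansatzDefect τ ζ φ) (x, f x) :=
    hA.contDiffAt_ansatzDefect hD hxD le_rfl hx.smooth_profile
  have h1 : ContDiffAt ℝ ∞ (fderiv ℝ (ansatzDefect τ ζ φ)) (x, f x) :=
    hG.fderiv_right (by simp)
  exact (ContDiffAt.comp x (f := fun y => (y, f y)) h1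
    (contDiffAt_id.prodMk hx.smooth)).clm_apply contDiffAt_const

theorem IsAnsatz.contDiffAt_comp_graph (hA : IsAnsatz D Q τ ζ) (hD : IsOpen D)
    (hxD : (x, f x) ∈ D) {r : ℕ∞ω} (hr : r ≤ ∞) (hf : ContDiffAt ℝ r f x) :
    ContDiffAt ℝ r (fun y => τ (y, f y)) x :=
  ContDiffAt.comp x (f := fun y => (y, f y)) ((hA.contDiffAt_τ hD hxD).of_le hr)
    (contDiffAt_id.prodMk hf)

end

section Solution

variable {n k k₁ m : ℕ} {D : Set (Pt n)} {P : DiffSystem n k Unit} {Q : Fin m → VField n}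
  {τ ζ : Pt n → ℝ} {R : ODE k₁} {Ω : Set (Base n)} {f : Base n → ℝ} {φ : ℝ → ℝ} {x : Base n}

/-- The profile of a solution solves the reduced equation, as the factor `μ` does not vanish. -/
theorem IsConditionallyInvariantSolution.solves_ode
    (hf : IsConditionallyInvariantSolution P D Q τ ζ Ω f) (hR : ReducesTo P D τ ζ R)
    (hΩ : IsOpen Ω) (hx : x ∈ Ω) (hφ : ContDiffAt ℝ k φ (τ (x, f x)))
    (hform : HasAnsatzForm τ ζ φ f x) :
    (τ (x, f x), derivs k₁ φ (τ (x, f x))) ∈ R.dom ∧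
      R.eqn (τ (x, f x), derivs k₁ φ (τ (x, f x))) = 0 := by
  obtain ⟨-, μ, hμ⟩ := hR
  obtain ⟨h1, -, h2, h3⟩ := hμ f φ x (hf.graph x hx) (hf.contDiff.contDiffAt (hΩ.mem_nhds hx)) hφ
    hform (hf.solves x hx).1
  rw [(hf.solves x hx).2 ()] at h3
  exact ⟨h1, (mul_eq_zero.1 h3.symm).resolve_left h2⟩

/-- A solution of class `C^k` and its profile are smooth: the profile by regularity for the reduced
equation, and the solution because it is defined implicitly by `ζ = φ ∘ τ`. -/
theorem IsConditionallyInvariantSolution.exists_smooth_ansatz (hk : 1 ≤ k)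
    (hf : IsConditionallyInvariantSolution P D Q τ ζ Ω f) (hD : IsOpen D)
    (hA : IsAnsatz D Q τ ζ) (hR : ReducesTo P D τ ζ R) (hΩ : IsOpen Ω) {x₀ : Base n}
    (hx₀ : x₀ ∈ Ω) : ∃ φ : ℝ → ℝ, ∀ᶠ x in 𝓝 x₀, IsSmoothAnsatzAt τ ζ φ f x := by
  obtain ⟨φ, hφ, hform⟩ := hf.ansatz x₀ hx₀
  refine ⟨φ, ?_⟩
  have hk0 : ((k : ℕ) : ℕ∞ω) ≠ 0 := by exact_mod_cast (by lia)
  have hk1 : (1 : ℕ∞ω) ≤ k := by exact_mod_cast hk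
  have hk2 : ((k : ℕ) : ℕ∞ω) ≤ ∞ := by exact_mod_cast le_top
  have hfk : ∀ x ∈ Ω, ContDiffAt ℝ k f x := fun x hx => hf.contDiff.contDiffAt (hΩ.mem_nhds hx)
  have hT : ContDiffAt ℝ k (fun y => τ (y, f y)) x₀ :=
    hA.contDiffAt_comp_graph hD (hf.graph _ hx₀) hk2 (hfk _ hx₀)
  have hT' := hA.fderiv_comp_graph_ne_zero hD (hf.graph _ hx₀)
    ((hfk _ hx₀).differentiableAt hk0) (hφ.differentiableAt hk0) hform
  have hφev : ∀ᶠ t in 𝓝 (τ (x₀, f x₀)), ContDiffAt ℝ k φ t := hφ.eventually (natCast_ne_infty k)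
  have hφx : ∀ᶠ x in 𝓝 x₀, ContDiffAt ℝ k φ (τ (x, f x)) := hT.continuousAt.eventually hφev
  have hformev : ∀ᶠ x in 𝓝 x₀, HasAnsatzForm τ ζ φ f x := eventually_eventually_nhds.2 hform
  have hode : ∀ᶠ x in 𝓝 x₀, (τ (x, f x), derivs k₁ φ (τ (x, f x))) ∈ R.dom ∧
      R.eqn (τ (x, f x), derivs k₁ φ (τ (x, f x))) = 0 := by
    filter_upwards [hφx, hformev, hΩ.mem_nhds hx₀] with x h1 h2 h3
    exact hf.solves_ode hR hΩ h3 h1 h2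
  have hode' := eventually_of_eventually_comp (p := fun t => (t, derivs k₁ φ t) ∈ R.dom ∧
    R.eqn (t, derivs k₁ φ t) = 0) (hT.of_le hk1) hT' hode
  have hφs : ∀ᶠ t in 𝓝 (τ (x₀, f x₀)), ContDiffAt ℝ ∞ φ t := by
    filter_upwards [hφev, eventually_eventually_nhds.2 hode'] with t h1 h2
    exact R.contDiffAt_solution (h1.of_le (by exact_mod_cast hR.1)) h2.self_of_nhds.1
      (h2.mono fun s hs => hs.2)
  filter_upwards [hT.continuousAt.eventually hφs, hformev, hΩ.mem_nhds hx₀] with x h1 h2 h3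
  refine ⟨?_, h1, h2⟩
  have hfx := hfk x h3
  exact contDiffAt_of_implicit (K := ansatzDefect τ ζ φ) (q := id) (by simp) contDiffAt_id
    hfx.continuousAt (hA.contDiffAt_ansatzDefect hD (hf.graph _ h3) le_rfl h1)
    (hA.ansatzWeight_ne_zero hD (hf.graph _ h3) (hfx.differentiableAt hk0)
      (h1.differentiableAt (by simp)) h2) (h2.mono fun y hy => sub_eq_zero.2 hy)

end Solution

/-! ### Deformation of a solution within the ansatz -/

theorem hasDerivAt_derivs {r : ℕ} {φ : ℝ → ℝ} {t : ℝ} (hφ : ContDiffAt ℝ ∞ φ t) :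
    HasDerivAt (derivs r φ) (deriv (derivs r φ) t) t :=
  ((contDiffAt_derivs (m := 1) hφ (by exact_mod_cast le_top)).differentiableAt
    (by simp)).hasDerivAt

theorem derivs_add_const_mul {r : ℕ} {φ χ : ℝ → ℝ} {t : ℝ} (hφ : ContDiffAt ℝ r φ t)
    (hχ : ContDiffAt ℝ r χ t) (ε : ℝ) :
    derivs r (fun s => φ s + ε * χ s) t = derivs r φ t + ε • derivs r χ t := by
  funext j
  have hj : ((j : ℕ) : ℕ∞ω) ≤ r := by exact_mod_cast Fin.is_le j
  simp only [derivs, Pi.add_apply, Pi.smul_apply, smul_eq_mul]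
  rw [iteratedDeriv_fun_add (hφ.of_le hj) (contDiffAt_const.mul (hχ.of_le hj)),
    iteratedDeriv_const_mul ε (hχ.of_le hj)]

section

variable {n k k₁ m : ℕ} {D : Set (Pt n)} {P : DiffSystem n k Unit} {Q : Fin m → VField n}
  {τ ζ : Pt n → ℝ} {R : ODE k₁} {Ω : Set (Base n)} {f : Base n → ℝ} {φ χ : ℝ → ℝ} {x : Base n}

/-- The graphs `ζ = (φ + ε χ) ∘ τ` near the graph of `f` are graphs of functions `F (·, ε)` that
depend smoothly on `ε`; the derivative by `ε` at `0`, times the weight, is `χ ∘ τ` on the graph. -/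
theorem IsAnsatz.exists_deformation (hA : IsAnsatz D Q τ ζ) (hD : IsOpen D) (hxD : (x, f x) ∈ D)
    (hx : IsSmoothAnsatzAt τ ζ φ f x) (hχ : ContDiffAt ℝ ∞ χ (τ (x, f x))) :
    ∃ F : Base n × ℝ → ℝ, ContDiffAt ℝ ∞ F (x, 0) ∧ (∀ᶠ y in 𝓝 x, F (y, 0) = f y) ∧
      (∀ᶠ q in 𝓝 (x, (0 : ℝ)), ζ (q.1, F q) = φ (τ (q.1, F q)) + q.2 * χ (τ (q.1, F q))) ∧
      ∀ᶠ y in 𝓝 x, ansatzWeight τ ζ φ f y * fderiv ℝ F (y, 0) (0, 1) = χ (τ (y, f y)) := by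
  have hfd : DifferentiableAt ℝ f x := hx.smooth.differentiableAt (by simp)
  have hφd : DifferentiableAt ℝ φ (τ (x, f x)) := hx.smooth_profile.differentiableAt (by simp)
  have hτ := hA.contDiffAt_τ hD hxD
  have hG : ContDiffAt ℝ ∞ (ansatzDefect τ ζ φ) (x, f x) :=
    hA.contDiffAt_ansatzDefect hD hxD le_rfl hx.smooth_profile
  have hG0 : ansatzDefect τ ζ φ (x, f x) = 0 := sub_eq_zero.2 hx.form.self_of_nhds
  have hχτ : ContDiffAt ℝ ∞ (fun p => χ (τ p)) (x, f x) := hχ.comp _ hτ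
  let K : (Base n × ℝ) × ℝ → ℝ := fun p =>
    ansatzDefect τ ζ φ (p.1.1, p.2) - p.1.2 * χ (τ (p.1.1, p.2))
  have hproj : ContDiffAt ℝ ∞ (fun p : (Base n × ℝ) × ℝ => ((p.1.1, p.2) : Pt n))
      ((x, 0), f x) := by fun_prop
  have hK : ContDiffAt ℝ ∞ K ((x, 0), f x) := by
    refine (ContDiffAt.comp (f := fun p : (Base n × ℝ) × ℝ => ((p.1.1, p.2) : Pt n))
      ((x, (0 : ℝ)), f x) hG hproj).sub (ContDiffAt.mul (by fun_prop)
      (ContDiffAt.comp (f := fun p : (Base n × ℝ) × ℝ => ((p.1.1, p.2) : Pt n))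
      ((x, (0 : ℝ)), f x) hχτ hproj))
  have hK0 : K ((x, 0), f x) = 0 := by simp [K, hG0]
  have hKz : fderiv ℝ K ((x, 0), f x) (0, 1) ≠ 0 := by
    have h1 : HasDerivAt (fun z : ℝ => (((x, 0), z) : (Base n × ℝ) × ℝ)) (0, 1) (f x) :=
      (hasDerivAt_const _ _).prodMk (hasDerivAt_id _)
    have h2 := (hK.differentiableAt (by simp)).hasFDerivAt.comp_hasDerivAt (f x) h1
    have h3 : HasDerivAt (fun z : ℝ => ((x, z) : Pt n)) (0, 1) (f x) :=
      (hasDerivAt_const _ _).prodMk (hasDerivAt_id _)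
    have h4 := (hG.differentiableAt (by simp)).hasFDerivAt.comp_hasDerivAt (f x) h3
    have h5 : (K ∘ fun z : ℝ => (((x, 0), z) : (Base n × ℝ) × ℝ)) =
        ansatzDefect τ ζ φ ∘ fun z : ℝ => ((x, z) : Pt n) := by
      funext z; simp [K]
    rw [h5] at h2
    rw [h2.unique h4]
    exact hA.ansatzWeight_ne_zero hD hxD hfd hφd hx.form
  obtain ⟨F, hF, hF0, hF'⟩ := exists_implicit_function (by simp) hK hKz
  rw [hK0] at hF'
  have hFc := hF.continuousAt
  have hfc := hx.smooth.continuousAt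
  have hsl : ContinuousAt (fun y : Base n => (y, (0 : ℝ))) x := by fun_prop
  have h1 : ∀ᶠ y in 𝓝 x, F (y, 0) = f y := by
    have hc : Tendsto (fun y => ((y, (0 : ℝ)), f y)) (𝓝 x) (𝓝 ((x, 0), f x)) := by
      have : ContinuousAt (fun y => ((y, (0 : ℝ)), f y)) x := by fun_prop
      exact this
    filter_upwards [hc.eventually hF', hx.form] with y hy hy'
    refine hy.1 ?_
    simp [K, ansatzDefect, hy']
  have h2 : ∀ᶠ q in 𝓝 (x, (0 : ℝ)), K (q, F q) = 0 := by
    have hc : Tendsto (fun q => (q, F q)) (𝓝 (x, (0 : ℝ))) (𝓝 ((x, 0), f x)) := by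
      have : ContinuousAt (fun q => (q, F q)) (x, (0 : ℝ)) := by fun_prop
      simpa [ContinuousAt, hF0] using this
    filter_upwards [hc.eventually hF'] with q hq
    exact hq.2 rfl
  refine ⟨F, hF, h1, ?_, ?_⟩
  · filter_upwards [h2] with q hq
    simp only [K, ansatzDefect] at hq
    linarith
  · have hgr : ContinuousAt (fun y => ((y, f y) : Pt n)) x := by fun_prop
    filter_upwards [h1, hsl.eventually (eventually_eventually_nhds.2 h2),
      hsl.eventually (eventually_contDiffAt (n := 1) hF),
      hgr.eventually (eventually_contDiffAt (n := 1) hG),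
      hgr.eventually (eventually_contDiffAt (n := 1) hχτ)] with y e1 e2 e3 e4 e5
    have hu : HasDerivAt (fun ε : ℝ => ((y, ε) : Base n × ℝ)) (0, 1) 0 :=
      (hasDerivAt_const _ _).prodMk (hasDerivAt_id _)
    have hFd := (e3.differentiableAt (by simp)).hasFDerivAt.comp_hasDerivAt (0 : ℝ) hu
    have hp : HasDerivAt (fun ε : ℝ => ((y, F (y, ε)) : Pt n))
        (0, fderiv ℝ F (y, 0) (0, 1)) 0 := (hasDerivAt_const _ _).prodMk hFd
    rw [← e1] at e4 e5
    have hGd := HasFDerivAt.comp_hasDerivAt (f := fun ε : ℝ => ((y, F (y, ε)) : Pt n)) (0 : ℝ)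
      (e4.differentiableAt (by simp)).hasFDerivAt hp
    have hc : ContinuousAt (fun ε : ℝ => χ (τ (y, F (y, ε)))) 0 :=
      ContinuousAt.comp (f := fun ε : ℝ => ((y, F (y, ε)) : Pt n)) e5.continuousAt
        hp.continuousAt
    have hd := hGd.sub (hasDerivAt_mul_of_zero hc (hasDerivAt_id (0 : ℝ)) rfl)
    have hz : HasDerivAt (fun ε : ℝ => ansatzDefect τ ζ φ (y, F (y, ε)) -
        χ (τ (y, F (y, ε))) * ε) 0 0 := by
      refine (hasDerivAt_const (0 : ℝ) (0 : ℝ)).congr_of_eventuallyEq ?_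
      filter_upwards [hu.continuousAt.eventually e2] with ε hε
      simp only [K] at hε
      linarith
    have he := hd.unique hz
    rw [e1] at he
    have hlin : ((0, fderiv ℝ F (y, 0) (0, 1)) : Pt n) =
        fderiv ℝ F (y, 0) (0, 1) • ((0, 1) : Pt n) := by simp
    rw [hlin, map_smul, smul_eq_mul] at he
    simp only [ansatzWeight]
    linarith

theorem hasDerivAt_jet {F : Base n × ℝ → ℝ} {g : Base n → ℝ} (hF : ContDiffAt ℝ ∞ F (x, 0))
    (hg : ∀ᶠ y in 𝓝 x, fderiv ℝ F (y, 0) (0, 1) = g y) :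
    HasDerivAt (fun ε : ℝ => jet k (fun y => F (y, ε)) x)
      (0, fun j : Fin (k + 1) => iteratedFDeriv ℝ (j : ℕ) g x) 0 := by
  refine (hasDerivAt_const _ _).prodMk (hasDerivAt_pi.2 fun j => ?_)
  have h1 := hasDerivAt_iteratedFDeriv_slice (j : ℕ) (F := F) (y := x) (ε := 0)
    (hF.of_le (natCast_le_infty _))
  have h2 : iteratedFDeriv ℝ (j : ℕ) (fun y => fderiv ℝ F (y, 0) (0, 1)) x =
      iteratedFDeriv ℝ (j : ℕ) g x :=
    (Filter.EventuallyEq.iteratedFDeriv (𝕜 := ℝ) hg (j : ℕ)).self_of_nhds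
  rwa [h2] at h1

/-- If the profile of the characteristic of a symmetry along the solution is `χ`, then `χ` solves
the reduced equation linearised at `φ`. Both sides of the reduction are differentiated along the
deformation with profiles `φ + ε χ`. -/
theorem linearized_ode (hD : IsOpen D) (hP : P.IsRegular) {X : VField n}
    (hXP : P.IsInvariant D X) (hA : IsAnsatz D Q τ ζ) (hR : ReducesTo P D τ ζ R)
    (hΩ : IsOpen Ω) (hf : IsConditionallyInvariantSolution P D Q τ ζ Ω f) (hxΩ : x ∈ Ω)
    (hx : ∀ᶠ y in 𝓝 x, IsSmoothAnsatzAt τ ζ φ f y) (hχ : ContDiffAt ℝ ∞ χ (τ (x, f x)))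
    (hχx : ∀ᶠ y in 𝓝 x, ansatzWeight τ ζ φ f y * characteristic X f y = χ (τ (y, f y))) :
    fderiv ℝ R.eqn (τ (x, f x), derivs k₁ φ (τ (x, f x))) (0, derivs k₁ χ (τ (x, f x))) = 0 := by
  have hx0 := hx.self_of_nhds
  have hxD := hf.graph x hxΩ
  have hτ := hA.contDiffAt_τ hD hxD
  have hk2 : ∀ r : ℕ, ((r : ℕ) : ℕ∞ω) ≤ ∞ := natCast_le_infty
  obtain ⟨F, hF, hF0, hFζ, hFχ⟩ := hA.exists_deformation hD hxD hx0 hχ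
  have hFx : F (x, 0) = f x := hF0.self_of_nhds
  have hFg : ∀ᶠ y in 𝓝 x, fderiv ℝ F (y, 0) (0, 1) = characteristic X f y := by
    filter_upwards [hFχ, hχx, hx, hΩ.mem_nhds hxΩ] with y h1 h2 h3 h4
    exact mul_left_cancel₀ (hA.ansatzWeight_ne_zero hD (hf.graph y h4)
      (h3.smooth.differentiableAt (by simp)) (h3.smooth_profile.differentiableAt (by simp))
      h3.form) (h1.trans h2.symm)
  have hjet := hasDerivAt_jet (k := k) hF hFg
  have hjet0 : jet k (fun y => F (y, 0)) x = jet k f x := by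
    refine Prod.ext rfl (funext fun j => ?_)
    exact (Filter.EventuallyEq.iteratedFDeriv (𝕜 := ℝ) hF0 (j : ℕ)).self_of_nhds
  have hsolves : ∀ᶠ y in 𝓝 x, P.Holds (jet k f y) := by
    filter_upwards [hΩ.mem_nhds hxΩ] with y hy using hf.solves y hy
  have hPd : DifferentiableAt ℝ (P.eqn ()) (jet k f x) :=
    ((hP.2 ()).contDiffAt (hP.1.mem_nhds (hf.solves x hxΩ).1)).differentiableAt (by simp)
  have hlin := hXP.fderiv_jet_characteristic hx0.smooth hxD hsolves () hPd
  -- the left-hand side of the equation along the deformation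
  have hp : HasDerivAt (fun ε : ℝ => P.eqn () (jet k (fun y => F (y, ε)) x)) 0 0 := by
    rw [← hjet0] at hPd hlin
    have := HasFDerivAt.comp_hasDerivAt (f := fun ε : ℝ => jet k (fun y => F (y, ε)) x)
      (0 : ℝ) hPd.hasFDerivAt hjet
    rwa [hlin] at this
  have hdom : ∀ᶠ ε in 𝓝 (0 : ℝ), jet k (fun y => F (y, ε)) x ∈ P.dom := by
    refine hjet.continuousAt.eventually (hP.1.mem_nhds ?_)
    change jet k (fun y => F (y, 0)) x ∈ P.dom
    rw [hjet0]
    exact (hf.solves x hxΩ).1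
  -- the argument of the profile along the deformation
  have hsl : HasDerivAt (fun ε : ℝ => ((x, ε) : Base n × ℝ)) (0, 1) 0 :=
    (hasDerivAt_const _ _).prodMk (hasDerivAt_id _)
  have hFd := (hF.differentiableAt (by simp)).hasFDerivAt.comp_hasDerivAt (0 : ℝ) hsl
  have hgr : HasDerivAt (fun ε : ℝ => ((x, F (x, ε)) : Pt n))
      (0, fderiv ℝ F (x, 0) (0, 1)) 0 := (hasDerivAt_const _ _).prodMk hFd
  set θ : ℝ → ℝ := fun ε => τ (x, F (x, ε)) with hθdef
  have hθ0 : θ 0 = τ (x, f x) := by simp only [hθdef, hFx]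
  obtain ⟨θ', hθ⟩ : ∃ θ', HasDerivAt θ θ' 0 := by
    have hτ' : HasFDerivAt τ (fderiv ℝ τ (x, f x)) (x, F (x, 0)) := by
      rw [hFx]; exact (hτ.differentiableAt (by simp)).hasFDerivAt
    exact ⟨_, HasFDerivAt.comp_hasDerivAt (f := fun ε : ℝ => ((x, F (x, ε)) : Pt n))
      (0 : ℝ) hτ' hgr⟩
  have hφ : ContDiffAt ℝ ∞ φ (θ 0) := by rw [hθ0]; exact hx0.smooth_profile
  have hχ' : ContDiffAt ℝ ∞ χ (θ 0) := by rw [hθ0]; exact hχ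
  have hderivs : ∀ r : ℕ, ∀ᶠ ε in 𝓝 (0 : ℝ),
      derivs r (fun s => φ s + ε * χ s) (θ ε) = derivs r φ (θ ε) + ε • derivs r χ (θ ε) := by
    intro r
    filter_upwards [hθ.continuousAt.eventually (eventually_contDiffAt (n := r) hφ),
      hθ.continuousAt.eventually (eventually_contDiffAt (n := r) hχ')] with ε h1 h2
    exact derivs_add_const_mul h1 h2 ε
  have hderivs' : ∀ r : ℕ, HasDerivAt (fun ε : ℝ => derivs r φ (θ ε) + ε • derivs r χ (θ ε))
      (θ' • deriv (derivs r φ) (θ 0) + derivs r χ (θ 0)) 0 := by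
    intro r
    have h1 := (hasDerivAt_derivs (r := r) hφ).scomp (0 : ℝ) hθ
    have h2 := (hasDerivAt_derivs (r := r) hχ').scomp (0 : ℝ) hθ
    have h3 : HasDerivAt (fun ε : ℝ => derivs r φ (θ ε) + ε • derivs r χ (θ ε))
        (θ' • deriv (derivs r φ) (θ 0) + ((0 : ℝ) • (θ' • deriv (derivs r χ) (θ 0)) +
          (1 : ℝ) • derivs r χ (θ 0))) 0 := h1.add ((hasDerivAt_id (0 : ℝ)).smul h2)
    rwa [zero_smul, zero_add, one_smul] at h3
  obtain ⟨hRdom, hRx⟩ := hf.solves_ode hR hΩ hxΩ (hx0.smooth_profile.of_le (hk2 k)) hx0.form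
  have hRd : HasFDerivAt R.eqn (fderiv ℝ R.eqn (θ 0, derivs k₁ φ (θ 0)))
      (θ 0, derivs k₁ φ (θ 0)) := by
    rw [hθ0]
    exact ((R.smooth.contDiffAt (R.isOpen_dom.mem_nhds hRdom)).differentiableAt
      (by simp)).hasFDerivAt
  -- the ordinary differential equation holds for `φ` near `θ 0`
  have hode : ∀ᶠ t in 𝓝 (θ 0), R.eqn (t, derivs k₁ φ t) = 0 := by
    rw [hθ0]
    refine eventually_of_eventually_comp (T := fun y => τ (y, f y)) (x₀ := x)
      ((hA.contDiffAt_comp_graph hD hxD le_rfl hx0.smooth).of_le (by exact_mod_cast le_top))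
      (hA.fderiv_comp_graph_ne_zero hD hxD (hx0.smooth.differentiableAt (by simp))
        (hx0.smooth_profile.differentiableAt (by simp)) hx0.form) ?_
    filter_upwards [hx, hΩ.mem_nhds hxΩ] with y h1 h2
    exact (hf.solves_ode hR hΩ h2 (h1.smooth_profile.of_le (hk2 k)) h1.form).2
  -- moving the argument of the profile does not change `H` to first order, since `H = 0` along `φ`
  have hshift : fderiv ℝ R.eqn (θ 0, derivs k₁ φ (θ 0)) (1, deriv (derivs k₁ φ) (θ 0)) = 0 := by
    have h1 := HasFDerivAt.comp_hasDerivAt (f := fun t : ℝ => (t, derivs k₁ φ t)) (θ 0) hRd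
      ((hasDerivAt_id (θ 0)).prodMk (hasDerivAt_derivs hφ))
    exact h1.unique ((hasDerivAt_const (θ 0) (0 : ℝ)).congr_of_eventuallyEq hode)
  have hq : HasDerivAt
      (fun ε : ℝ => R.eqn (θ ε, derivs k₁ (fun s => φ s + ε * χ s) (θ ε)))
      (fderiv ℝ R.eqn (θ 0, derivs k₁ φ (θ 0)) (0, derivs k₁ χ (θ 0))) 0 := by
    have h1 : HasFDerivAt R.eqn (fderiv ℝ R.eqn (θ 0, derivs k₁ φ (θ 0)))
      (θ 0, derivs k₁ φ (θ 0) + (0 : ℝ) • derivs k₁ χ (θ 0)) := by simpa using hRd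
    have h2 := HasFDerivAt.comp_hasDerivAt
      (f := fun ε : ℝ => (θ ε, derivs k₁ φ (θ ε) + ε • derivs k₁ χ (θ ε))) (0 : ℝ) h1
      (hθ.prodMk (hderivs' k₁))
    have h3 : ((θ', θ' • deriv (derivs k₁ φ) (θ 0) + derivs k₁ χ (θ 0)) :
        ℝ × (Fin (k₁ + 1) → ℝ)) =
        θ' • (1, deriv (derivs k₁ φ) (θ 0)) + (0, derivs k₁ χ (θ 0)) := by
      ext <;> simp
    rw [h3, map_add, map_smul, hshift, smul_zero, zero_add] at h2
    refine h2.congr_of_eventuallyEq ?_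
    filter_upwards [hderivs k₁] with ε hε
    simp only [Function.comp_apply, hε]
  obtain ⟨-, μ, hμ⟩ := hR
  -- the reduction applied to the deformation
  have hred : ∀ᶠ ε in 𝓝 (0 : ℝ), P.eqn () (jet k (fun y => F (y, ε)) x) =
      μ (x, F (x, ε), derivs k (fun s => φ s + ε * χ s) (θ ε)) *
        R.eqn (θ ε, derivs k₁ (fun s => φ s + ε * χ s) (θ ε)) := by
    have hFD : ∀ᶠ ε in 𝓝 (0 : ℝ), (x, F (x, ε)) ∈ D := by
      refine hgr.continuousAt.eventually (hD.mem_nhds ?_)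
      change (x, F (x, 0)) ∈ D
      rw [hFx]; exact hxD
    filter_upwards [hFD, hdom,
      hsl.continuousAt.eventually (eventually_contDiffAt (n := k) hF),
      hsl.continuousAt.eventually (eventually_eventually_nhds.2 hFζ),
      hθ.continuousAt.eventually (eventually_contDiffAt (n := k) hφ),
      hθ.continuousAt.eventually (eventually_contDiffAt (n := k) hχ')] with ε h1 h2 h3 h4 h5 h6
    have hc : ContinuousAt (fun y : Base n => (y, ε)) x := by fun_prop
    have h7 : ContDiffAt ℝ k (fun y => F (y, ε)) x :=
      ContDiffAt.comp x (f := fun y : Base n => (y, ε)) h3 (by fun_prop)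
    exact (hμ (fun y => F (y, ε)) (fun s => φ s + ε * χ s) x h1 h7
      (h5.add (contDiffAt_const.mul h6)) (hc.eventually h4) h2).2.2.2
  obtain ⟨-, hμs, hμ0, -⟩ := hμ f φ x hxD (hx0.smooth.of_le (hk2 k))
    (hx0.smooth_profile.of_le (hk2 k)) hx0.form (hf.solves x hxΩ).1
  have hμc : ContinuousAt
      (fun ε : ℝ => μ (x, F (x, ε), derivs k (fun s => φ s + ε * χ s) (θ ε))) 0 := by
    have h1 : ContinuousAt (fun ε : ℝ => (x, F (x, ε),
        derivs k (fun s => φ s + ε * χ s) (θ ε))) 0 :=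
      continuousAt_const.prodMk (hFd.continuousAt.prodMk
        ((hderivs' k).continuousAt.congr (Filter.EventuallyEq.symm (hderivs k))))
    refine ContinuousAt.comp (f := fun ε : ℝ => (x, F (x, ε),
        derivs k (fun s => φ s + ε * χ s) (θ ε))) ?_ h1
    simpa [hFx, hθ0] using hμs.continuousAt
  have hprod := hasDerivAt_mul_of_zero hμc hq (by simpa [hθ0] using hRx)
  have h1 := hprod.unique (hp.congr_of_eventuallyEq (hred.mono fun ε hε => hε.symm))
  rw [← hθ0]
  refine (mul_eq_zero.1 h1).resolve_left ?_
  simpa [hFx, hθ0] using hμ0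

end

/-! ### Local profiles and the invariance of the solution -/

theorem characteristic_sum {n s : ℕ} (X : Fin s → VField n) (c : Fin s → ℝ) (f : Base n → ℝ)
    (x : Base n) :
    characteristic (∑ i, c i • X i) f x = ∑ i, c i * characteristic (X i) f x := by
  simp only [characteristic, Finset.sum_apply, Pi.smul_apply, Prod.fst_sum, Prod.snd_sum,
    Prod.smul_fst, Prod.smul_snd, map_sum, map_smul, smul_eq_mul, mul_sub,
    Finset.sum_sub_distrib]

theorem derivs_sum {s r : ℕ} (c : Fin s → ℝ) {χ : Fin s → ℝ → ℝ} {t : ℝ}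
    (hχ : ∀ i, ContDiffAt ℝ ∞ (χ i) t) :
    derivs r (fun u => ∑ i, c i * χ i u) t = ∑ i, c i • derivs r (χ i) t := by
  funext j
  have hj : ∀ i, ContDiffAt ℝ (j : ℕ) (χ i) t := fun i => (hχ i).of_le (natCast_le_infty _)
  simp only [derivs, Finset.sum_apply, Pi.smul_apply, smul_eq_mul]
  rw [iteratedDeriv_fun_sum fun i _ => contDiffAt_const.mul (hj i)]
  exact Finset.sum_congr rfl fun i _ => iteratedDeriv_const_mul _ (hj i)

section

variable {n k k₁ m s : ℕ} {D : Set (Pt n)} {P : DiffSystem n k Unit} {Q : Fin m → VField n}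
  {X : Fin s → VField n} {τ ζ : Pt n → ℝ} {R : ODE k₁} {Ω : Set (Base n)} {f : Base n → ℝ}

/-- Near every point of `Ω` the characteristics of the vector fields `X i` are, up to the common
factor `w`, functions `χ i` of the single variable `T`, which runs through an interval on which the
combinations of the `χ i` are determined by their derivatives of order less than `k₁` at one point.
The second conjunct says that `T` is open on `V`. -/
theorem exists_local_profiles (hk : 1 ≤ k) (hD : IsOpen D) (hP : P.IsRegular)
    (hX : ∀ i, ContDiffOn ℝ ∞ (X i) D) (hXP : ∀ i, P.IsInvariant D (X i))
    (hQ : ∀ a, ContDiffOn ℝ ∞ (Q a) D) (hA : IsAnsatz D Q τ ζ) (hR : ReducesTo P D τ ζ R)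
    (hXQ : ∀ i, (invariantSurfaceSystem D Q).IsInvariant D (X i)) (hΩ : IsOpen Ω)
    (hf : IsConditionallyInvariantSolution P D Q τ ζ Ω f) {x₀ : Base n} (hx₀ : x₀ ∈ Ω) :
    ∃ V ∈ 𝓝 x₀, ∃ (T w : Base n → ℝ) (a b : ℝ) (χ : Fin s → ℝ → ℝ),
      (∀ x ∈ V, T x ∈ Ioo a b ∧ w x ≠ 0 ∧ ∀ i, w x * characteristic (X i) f x = χ i (T x)) ∧
      (∀ x ∈ V, ∀ p : ℝ → Prop, (∀ᶠ y in 𝓝 x, p (T y)) → ∀ᶠ t in 𝓝 (T x), p t) ∧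
      (∀ t ∈ Ioo a b, ∀ i, ContDiffAt ℝ ∞ (χ i) t) ∧
      ∀ c : Fin s → ℝ, ∀ t₁ ∈ Ioo a b,
        (∀ j : Fin k₁, ∑ i, c i * iteratedDeriv j (χ i) t₁ = 0) →
        ∀ t ∈ Ioo a b, ∑ i, c i * χ i t = 0 := by
  obtain ⟨φ, hφ⟩ := hf.exists_smooth_ansatz hk hD hA hR hΩ hx₀
  set T : Base n → ℝ := fun x => τ (x, f x)
  set w : Base n → ℝ := ansatzWeight τ ζ φ f
  have hev : ∀ᶠ x in 𝓝 x₀, x ∈ Ω ∧ IsSmoothAnsatzAt τ ζ φ f x :=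
    (hΩ.eventually_mem hx₀).and hφ
  have hTs : ∀ x, x ∈ Ω → IsSmoothAnsatzAt τ ζ φ f x → ContDiffAt ℝ ∞ T x := fun x h1 h2 =>
    hA.contDiffAt_comp_graph hD (hf.graph x h1) le_rfl h2.smooth
  have hT' : ∀ x, x ∈ Ω → IsSmoothAnsatzAt τ ζ φ f x → fderiv ℝ T x ≠ 0 := fun x h1 h2 =>
    hA.fderiv_comp_graph_ne_zero hD (hf.graph x h1) (h2.smooth.differentiableAt (by simp))
      (h2.smooth_profile.differentiableAt (by simp)) h2.form
  have hT1 : ∀ x, x ∈ Ω → IsSmoothAnsatzAt τ ζ φ f x → ContDiffAt ℝ 1 T x := fun x h1 h2 =>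
    (hTs x h1 h2).of_le (by exact_mod_cast le_top)
  have hw : ∀ x, x ∈ Ω → IsSmoothAnsatzAt τ ζ φ f x → w x ≠ 0 := fun x h1 h2 =>
    hA.ansatzWeight_ne_zero hD (hf.graph x h1) (h2.smooth.differentiableAt (by simp))
      (h2.smooth_profile.differentiableAt (by simp)) h2.form
  have hhs : ∀ x, x ∈ Ω → IsSmoothAnsatzAt τ ζ φ f x → ∀ i,
      ContDiffAt ℝ ∞ (fun y => w y * characteristic (X i) f y) x := fun x h1 h2 i =>
    (hA.contDiffAt_ansatzWeight hD (hf.graph x h1) h2).mul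
      (contDiffAt_characteristic ((hX i).contDiffAt (hD.mem_nhds (hf.graph x h1))) h2.smooth)
  have hker : ∀ i, ∀ᶠ x in 𝓝 x₀, ∀ v, fderiv ℝ T x v = 0 →
      fderiv ℝ (fun y => w y * characteristic (X i) f y) x v = 0 := by
    intro i
    filter_upwards [hev] with x h1 v hv
    exact hA.fderiv_weight_mul_characteristic hD hQ (hX i) (hXQ i) (hf.graph x h1.1) h1.2
      ((hΩ.eventually_mem h1.1).mono fun y hy => hf.solves_system y hy) hv
  choose χ hχ using fun i => exists_factor (hTs x₀ hx₀ hφ.self_of_nhds)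
    (hT' x₀ hx₀ hφ.self_of_nhds) (hhs x₀ hx₀ hφ.self_of_nhds i) (hker i)
  have hall : ∀ᶠ x in 𝓝 x₀, (x ∈ Ω ∧ IsSmoothAnsatzAt τ ζ φ f x) ∧
      (∀ i, w x * characteristic (X i) f x = χ i (T x)) ∧
      ∀ i, ContDiffAt ℝ ∞ (χ i) (T x) ∧
        fderiv ℝ R.eqn (T x, derivs k₁ φ (T x)) (0, derivs k₁ (χ i) (T x)) = 0 := by
    filter_upwards [hev, eventually_eventually_nhds.2 hφ,
      eventually_eventually_nhds.2 (eventually_all.2 hχ)] with x h1 h2 h3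
    have h4 : ∀ i, ContDiffAt ℝ ∞ (χ i) (T x) := fun i =>
      contDiffAt_of_comp (hTs x h1.1 h1.2) (hT' x h1.1 h1.2) (hhs x h1.1 h1.2 i)
        (h3.mono fun y hy => hy i)
    exact ⟨h1, h3.self_of_nhds, fun i => ⟨h4 i, linearized_ode hD hP (hXP i) hA hR hΩ hf h1.1 h2
      (h4 i) (h3.mono fun y hy => hy i)⟩⟩
  have ht := eventually_of_eventually_comp (p := fun t => ∀ i, ContDiffAt ℝ ∞ (χ i) t ∧
    fderiv ℝ R.eqn (t, derivs k₁ φ t) (0, derivs k₁ (χ i) t) = 0)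
    (hT1 x₀ hx₀ hφ.self_of_nhds) (hT' x₀ hx₀ hφ.self_of_nhds) (hall.mono fun x hx => hx.2.2)
  have hsol := hf.solves_ode hR hΩ hx₀
    (hφ.self_of_nhds.smooth_profile.of_le (natCast_le_infty k)) hφ.self_of_nhds.form
  -- one interval on which uniqueness holds and all profiles solve the linearised equation
  obtain ⟨U, hU, hUuniq⟩ := R.exists_nhds_linearized_unique hφ.self_of_nhds.smooth_profile
    hsol.1 hsol.2
  obtain ⟨a, b, hab, habU⟩ := mem_nhds_iff_exists_Ioo_subset.1 (inter_mem hU ht)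
  have hTab : ∀ᶠ x in 𝓝 x₀, T x ∈ Ioo a b :=
    (hTs x₀ hx₀ hφ.self_of_nhds).continuousAt.eventually (isOpen_Ioo.mem_nhds hab)
  refine ⟨_, hall.and hTab, T, w, a, b, χ, ?_, ?_, ?_, ?_⟩
  · rintro x ⟨⟨h1, h2, -⟩, h3⟩
    exact ⟨h3, hw x h1.1 h1.2, h2⟩
  · rintro x ⟨⟨h1, -, -⟩, -⟩ p hp
    exact eventually_of_eventually_comp (hT1 x h1.1 h1.2) (hT' x h1.1 h1.2) hp
  · exact fun t h i => ((habU h).2 i).1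
  · intro c t₁ ht₁ h0
    refine hUuniq a b (fun t h => (habU h).1) (fun t => ∑ i, c i * χ i t) ?_ t₁ ht₁ ?_
    · intro t h
      have h1 := (habU h).2
      refine ⟨ContDiffAt.sum fun i _ => contDiffAt_const.mul (h1 i).1, ?_⟩
      have h2 : ((0, derivs k₁ (fun u => ∑ i, c i * χ i u) t) : ℝ × (Fin (k₁ + 1) → ℝ)) =
          ∑ i, c i • (0, derivs k₁ (χ i) t) := by
        rw [derivs_sum c fun i => (h1 i).1]
        refine Prod.ext ?_ ?_
        · simp [Prod.fst_sum]
        · simp [Prod.snd_sum]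
      rw [h2, map_sum]
      refine Finset.sum_eq_zero fun i _ => ?_
      rw [map_smul, (h1 i).2, smul_zero]
    · intro j
      have h1 := congrFun (derivs_sum (r := k₁) c fun i => ((habU ht₁).2 i).1) j.castSucc
      simp only [derivs, Finset.sum_apply, Pi.smul_apply, smul_eq_mul, Fin.val_castSucc] at h1
      rw [h1]
      exact h0 j

end

end SymRed

theorem theorem2 {n k k₁ m s : ℕ} (hk : 1 ≤ k)
    (D : Set (Pt n)) (hD : IsOpen D)
    -- the partial differential equation
    (P : DiffSystem n k Unit) (hP : P.IsRegular)
    -- it is invariant under an `s`-dimensional Lie algebra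
    (X : Fin s → VField n) (hX : IsLieAlgebraBasis D X)
    (hXP : ∀ i, P.IsInvariant D (X i))
    -- it is conditionally invariant under an involutive family
    (Q : Fin m → VField n) (hQ : ∀ a, ContDiffOn ℝ ∞ (Q a) D) (hQinv : IsInvolutive D Q)
    (hPQ : P.IsConditionallyInvariant D Q)
    -- whose ansatz reduces it to an ordinary differential equation of order `k₁`
    (τ ζ : Pt n → ℝ) (hA : IsAnsatz D Q τ ζ) (R : ODE k₁) (hR : ReducesTo P D τ ζ R)
    -- the system of the family is invariant under the Lie algebra
    (hXQ : ∀ i, (invariantSurfaceSystem D Q).IsInvariant D (X i))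
    (hs : k₁ + 1 ≤ s)
    -- a conditionally invariant solution on a domain
    (Ω : Set (Base n)) (hΩ : IsOpen Ω) (hΩc : IsConnected Ω)
    (f : Base n → ℝ) (hf : IsConditionallyInvariantSolution P D Q τ ζ Ω f) :
    ∃ Y ∈ Submodule.span ℝ (range X), (∃ p ∈ D, Y p ≠ 0) ∧ IsInvariantFunction Y Ω f := by
  have hloc := fun {x₀ : Base n} (hx₀ : x₀ ∈ Ω) => exists_local_profiles hk hD hP hX.smooth hXP
    hQ hA hR hXQ hΩ hf hx₀
  obtain ⟨x₀, hx₀⟩ := hΩc.nonempty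
  -- a combination whose profile has vanishing initial data
  obtain ⟨c, hc, hcx₀⟩ : ∃ c : Fin s → ℝ, c ≠ 0 ∧
      ∀ᶠ x in 𝓝 x₀, ∑ i, c i * characteristic (X i) f x = 0 := by
    obtain ⟨V, hV, T, w, a, b, χ, hVT, -, -, huniq⟩ := hloc hx₀
    let L : (Fin s → ℝ) →ₗ[ℝ] (Fin k₁ → ℝ) :=
      LinearMap.pi fun j => ∑ i, iteratedDeriv j (χ i) (T x₀) • LinearMap.proj i
    obtain ⟨c, hcL, hc⟩ := Submodule.exists_mem_ne_zero_of_ne_bot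
      (LinearMap.ker_ne_bot_of_finrank_lt (f := L) (by simpa using hs))
    refine ⟨c, hc, ?_⟩
    have h0 : ∀ j : Fin k₁, ∑ i, c i * iteratedDeriv j (χ i) (T x₀) = 0 := by
      intro j
      have h1 := congrFun (LinearMap.mem_ker.1 hcL) j
      simpa [L, mul_comm] using h1
    filter_upwards [hV] with x hx
    obtain ⟨h1, h2, h3⟩ := hVT x hx
    have h4 := huniq c _ (hVT x₀ (mem_of_mem_nhds hV)).1 h0 _ h1
    refine mul_left_cancel₀ h2 ?_
    rw [mul_zero, ← h4, Finset.mul_sum]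
    exact Finset.sum_congr rfl fun i _ => by rw [← h3 i]; ring
  refine ⟨∑ i, c i • X i, Submodule.sum_mem _ fun i _ =>
    Submodule.smul_mem _ _ (Submodule.subset_span (mem_range_self i)), ?_, ?_⟩
  · by_contra! hY
    refine hc (hX.independent c fun p hp => ?_)
    simpa using hY p hp
  -- the set where the characteristic vanishes nearby is open, and closed in `Ω`
  · let A : Set (Base n) := {x | ∀ᶠ y in 𝓝 x, ∑ i, c i * characteristic (X i) f y = 0}
    have hAo : IsOpen A := isOpen_setOfPred_eventually_nhds
    have hsub : Ω ⊆ A := by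
      refine hΩc.isPreconnected.subset_of_closure_inter_subset hAo ⟨x₀, hx₀, hcx₀⟩ ?_
      rintro x ⟨hxA, hxΩ⟩
      obtain ⟨V, hV, T, w, a, b, χ, hVT, hopen, hsm, huniq⟩ := hloc hxΩ
      have hVi : interior V ∈ 𝓝 x := interior_mem_nhds.2 hV
      obtain ⟨x₁, hx₁V, hx₁A⟩ := mem_closure_iff_nhds.1 hxA _ hVi
      have hx₁ := interior_subset hx₁V
      have hzero : ∀ᶠ t in 𝓝 (T x₁), ∑ i, c i * χ i t = 0 := by
        refine hopen x₁ hx₁ (fun t => ∑ i, c i * χ i t = 0) ?_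
        filter_upwards [hx₁A, isOpen_interior.mem_nhds hx₁V] with y h1 h2
        have h3 := (hVT y (interior_subset h2)).2.2
        calc ∑ i, c i * χ i (T y) = w y * ∑ i, c i * characteristic (X i) f y := by
              rw [Finset.mul_sum]
              exact Finset.sum_congr rfl fun i _ => by rw [← h3 i]; ring
          _ = 0 := by rw [h1, mul_zero]
      have hdata : ∀ j : Fin k₁, ∑ i, c i * iteratedDeriv j (χ i) (T x₁) = 0 := by
        intro j
        have h1 := congrFun (derivs_sum (r := k₁) c (hsm _ (hVT x₁ hx₁).1)) j.castSucc
        simp only [derivs, Finset.sum_apply, Pi.smul_apply, smul_eq_mul, Fin.val_castSucc] at h1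
        rw [← h1]
        have h2 : (fun t => ∑ i, c i * χ i t) =ᶠ[𝓝 (T x₁)] fun _ => (0 : ℝ) := hzero
        rw [h2.iteratedDeriv_eq]
        simp
      have hall := huniq c _ (hVT x₁ hx₁).1 hdata
      change ∀ᶠ y in 𝓝 x, ∑ i, c i * characteristic (X i) f y = 0
      filter_upwards [hV] with y hy
      obtain ⟨h1, h2, h3⟩ := hVT y hy
      refine mul_left_cancel₀ h2 ?_
      rw [mul_zero, ← hall _ h1, Finset.mul_sum]
      exact Finset.sum_congr rfl fun i _ => by rw [← h3 i]; ring
    intro x hx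
    rw [characteristic_sum]
    exact (hsub hx).self_of_nhds
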